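/- Let $d,d^*$ be non-negative integers, $\beta>0$ and $K$ real numbers, and write $|\cdot|_\infty$ for the maximum norm. *Hölder classes.* For a set $D\subseteq\mathbb{R}^r$ and $\gamma>0$, a function $g:D\to\mathbb{R}$ belongs to $C^\gamma_r(D,K')$ if for every $a\in D$ there is a polynomial $P_a(x)=\sum_{|\alpha|<\gamma}c_{\alpha,a}x^\alpha$ with $\alpha!\,|c_{\alpha,a}|\le K'$ for all $\alpha$ and $|g(x)-P_a(x)|\le K'|x-a|_\infty^\gamma$ for all $x\in D$; a vector-valued function belongs to $C^\gamma_r(D)$ if for some $K'>0$ all its components belong to $C^\gamma_r(D,K')$. With $\lfloor\beta\rfloor$ the largest integer strictly smaller than $\beta$, $\mathcal{C}^\beta_d(\mathbb{R}^d,K)$ is the set of functions $f:\mathbb{R}^d\to\mathbb{R}$ of class $C^{\lfloor\beta\rfloor}$ with $$\sum_{|\alpha|<\beta}\|\partial^\alpha f\|_{L^\infty(\mathbb{R}^d)}+\sum_{|\alpha|=\lfloor\beta\rfloor}\ \sup_{x\ne y}\frac{|\partial^\alpha f(x)-\partial^\alpha f(y)|}{|x-y|_\infty^{\beta-\lfloor\beta\rfloor}}\le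 K .$$ *Manifolds.* A compact set $\mathcal{M}\subset\mathbb{R}^d$ is a compact $d^*$-dimensional manifold with smooth local coordinates if there are finitely many relatively open sets $V_1,\dots,V_r\subseteq\mathcal{M}$ with $\bigcup_jV_j=\mathcal{M}$ and homeomorphisms $\psi_j$ from $V_j$ onto open sets $\psi_j(V_j)\subseteq\mathbb{R}^{d^*}$ such that $\psi_j\in C^\gamma_d(V_j)$ and $\psi_j^{-1}\in C^\gamma_{d^*}(\psi_j(V_j))$ for every $\gamma>0$ and every $j$. *Networks.* $\mathcal{F}(L,(d\sim p\sim 1),s)$ is the set of functions $x\mapsto W_L\sigma_{v_L}W_{L-1}\sigma_{v_{L-1}}\cdots W_1\sigma_{v_1}W_0x$ from $\mathbb{R}^d$ to $\mathbb{R}$, where all $L$ hidden layers have width $p$, $\sigma_v(y)=(\max(y_i-v_i,0))_i$, all entries of the weight matrices $W_0,\dots,W_L$ and shift vectors $v_1,\dots,v_L$ have absolute value at most $1$, and at most $s$ of these entries in total are non-zero. **Theorem.** Let $\mathcal{M}\subset\mathbb{R}^d$ be a compact $d^*$-dimensional manifold with smooth local coordinates. Then there are positive constants $c,C,C'$, depending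 only on $\mathcal{M},d,d^*,\beta,K$, such that for all $0<\eta\le 1/2$ and all non-negative integers $L,p,s$ with $L\ge c\log(1/\eta)$, $p>C\eta^{-d^*/\beta}$ and $s\ge C'L\eta^{-d^*/\beta}$, the following holds: for every $f:\mathbb{R}^d\to[-1,1]$ with $f\in\mathcal{C}^\beta_d(\mathbb{R}^d,K)$ there is $\widetilde f\in\mathcal{F}(L,(d\sim p\sim 1),s)$ with $\sup_{x\in\mathcal{M}}|\widetilde f(x)-f(x)|\le\eta$. -/

import Mathlib

namespace DeepReLU

/-- Architectures with input dimension `p`, a list of hidden layer widths and an output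
dimension `q`, together with their parameters. The network
`W_L σ_{v_L} W_{L-1} ⋯ W_1 σ_{v_1} W_0` is stored from the input side; the number of hidden
layers `L` is the length of the list. The last weight matrix carries no shift, and there is no
shift before `W_0`. -/
inductive Network : ℕ → List ℕ → ℕ → Type where
  | out {p q : ℕ} (W : Matrix (Fin q) (Fin p) ℝ) : Network p [] q
  | layer {p h q : ℕ} {hs : List ℕ} (W : Matrix (Fin h) (Fin p) ℝ) (v : Fin h → ℝ)
      (N : Network h hs q) : Network p (h :: hs) q

/-- The shifted ReLU activation `σ_v(y) = (max (y_i - v_i) 0)_i`. -/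
noncomputable def shiftedReLU {n : ℕ} (v y : Fin n → ℝ) : Fin n → ℝ :=
  fun i => max (y i - v i) 0

/-- Number of non-zero entries of a matrix. -/
noncomputable def matNonzero {m n : ℕ} (W : Matrix (Fin m) (Fin n) ℝ) : ℕ :=
  (Finset.univ.filter fun ij : Fin m × Fin n => W ij.1 ij.2 ≠ 0).card

/-- Number of non-zero entries of a vector. -/
noncomputable def vecNonzero {n : ℕ} (v : Fin n → ℝ) : ℕ :=
  (Finset.univ.filter fun i : Fin n => v i ≠ 0).card

namespace Network

/-- The function computed by a network (the output activation is the identity). -/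
noncomputable def eval : {p : ℕ} → {hs : List ℕ} → {q : ℕ} → Network p hs q →
    (Fin p → ℝ) → (Fin q → ℝ)
  | _, _, _, .out W, x => W.mulVec x
  | _, _, _, .layer W v N, x => N.eval (shiftedReLU v (W.mulVec x))

/-- Number of non-zero parameters: entries of all weight matrices and shift vectors. -/
noncomputable def numNonzero : {p : ℕ} → {hs : List ℕ} → {q : ℕ} → Network p hs q → ℕ
  | _, _, _, .out W => matNonzero W
  | _, _, _, .layer W v N => matNonzero W + vecNonzero v + N.numNonzero

/-- All parameters have absolute value at most one. -/
def BoundedByOne : {p : ℕ} → {hs : List ℕ} → {q : ℕ} → Network p hs q → Prop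
  | _, _, _, .out W => ∀ i j, |W i j| ≤ 1
  | _, _, _, .layer W v N => (∀ i j, |W i j| ≤ 1) ∧ (∀ i, |v i| ≤ 1) ∧ N.BoundedByOne

end Network

/-- The class of functions computed by `s`-sparse ReLU networks with input dimension `p`, hidden
layer widths `hs`, output dimension `q` and all parameters bounded by one in absolute value. -/
def sparseClass (p : ℕ) (hs : List ℕ) (q s : ℕ) : Set ((Fin p → ℝ) → (Fin q → ℝ)) :=
  {g | ∃ N : Network p hs q, N.BoundedByOne ∧ N.numNonzero ≤ s ∧ N.eval = g}

/-- The class `F(L, (p₀ ∼ p ∼ q), s)`: `L` hidden layers, all of width `p`. -/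
def uniformClass (L p₀ p q s : ℕ) : Set ((Fin p₀ → ℝ) → (Fin q → ℝ)) :=
  sparseClass p₀ (List.replicate L p) q s

/-- The partial derivative in the `i`-th coordinate (of a differentiable function). -/
noncomputable def partialDeriv {r : ℕ} (i : Fin r) (f : (Fin r → ℝ) → ℝ) : (Fin r → ℝ) → ℝ :=
  fun x => fderiv ℝ f x (Pi.single i 1)

/-- The mixed partial derivative `∂^α = ∂₁^{α₁} ⋯ ∂ᵣ^{αᵣ}`. -/
noncomputable def multiDeriv {r : ℕ} (α : Fin r → ℕ) (f : (Fin r → ℝ) → ℝ) : (Fin r → ℝ) → ℝ :=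
  (List.finRange r).foldr (fun i g => (partialDeriv i)^[α i] g) f

/-- The largest integer strictly smaller than `β` (for `β > 0`). -/
noncomputable def strictFloor (β : ℝ) : ℕ := ⌈β⌉₊ - 1

/-- The `β`-Hölder norm on `ℝ^r`: the sum of `‖∂^α f‖_∞` over `|α| < β` (that is,
`|α| < ⌈β⌉`) plus the sum of the Hölder seminorms of `∂^α f` over `|α| = strictFloor β`.
The norm on `Fin r → ℝ` is the maximum norm. -/
noncomputable def holderNorm {r : ℕ} (β : ℝ) (f : (Fin r → ℝ) → ℝ) : ENNReal :=
  (∑ k ∈ Finset.range ⌈β⌉₊, ∑ α ∈ Finset.piAntidiag (Finset.univ : Finset (Fin r)) k,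
      ⨆ x : Fin r → ℝ, ENNReal.ofReal |multiDeriv α f x|) +
    ∑ α ∈ Finset.piAntidiag (Finset.univ : Finset (Fin r)) (strictFloor β),
      ⨆ (x : Fin r → ℝ) (y : Fin r → ℝ) (_ : x ≠ y),
        ENNReal.ofReal
          (|multiDeriv α f x - multiDeriv α f y| / ‖x - y‖ ^ (β - (strictFloor β : ℝ)))

/-- The ball of radius `K` of `β`-Hölder functions on all of `ℝ^r`. -/
def holderBall (r : ℕ) (β K : ℝ) : Set ((Fin r → ℝ) → ℝ) :=
  {f | ContDiff ℝ (strictFloor β) f ∧ holderNorm β f ≤ ENNReal.ofReal K}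

/-- Hölder functions on an arbitrary set `D ⊆ ℝ^r` through local polynomial approximation: at
every `a ∈ D` there is a polynomial `P_a` of degree smaller than `β`, with coefficients `c_γ`
satisfying `γ! |c_γ| ≤ K`, such that `|f x - P_a x| ≤ K |x - a|_∞ ^ β` for all `x ∈ D`. -/
def PolyHolderWith {r : ℕ} (β K : ℝ) (D : Set (Fin r → ℝ)) (f : (Fin r → ℝ) → ℝ) : Prop :=
  ∀ a ∈ D, ∃ P : MvPolynomial (Fin r) ℝ, (P.totalDegree : ℝ) < β ∧
    (∀ x ∈ D, |f x - MvPolynomial.eval x P| ≤ K * ‖x - a‖ ^ β) ∧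
    ∀ γ : Fin r →₀ ℕ, ((∏ i, (γ i).factorial : ℕ) : ℝ) * |MvPolynomial.coeff γ P| ≤ K

/-- A vector valued map is `β`-Hölder on `D` in the polynomial sense if all its components are,
for a common constant `K > 0`. -/
def PolyHolder {r q : ℕ} (β : ℝ) (D : Set (Fin r → ℝ)) (f : (Fin r → ℝ) → (Fin q → ℝ)) : Prop :=
  ∃ K : ℝ, 0 < K ∧ ∀ i : Fin q, PolyHolderWith β K D (fun x => f x i)

/-- `ψ` is an `n`-dimensional chart of `M ⊆ ℝ^d`: a homeomorphism from a relatively open subset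
`ψ.source` of `M` onto an open subset `ψ.target` of `ℝ^n`. -/
structure IsChart {d n : ℕ} (M : Set (Fin d → ℝ))
    (ψ : PartialEquiv (Fin d → ℝ) (Fin n → ℝ)) : Prop where
  source_relOpen : ∃ U : Set (Fin d → ℝ), IsOpen U ∧ ψ.source = M ∩ U
  target_open : IsOpen ψ.target
  continuousOn : ContinuousOn ψ ψ.source
  continuousOn_symm : ContinuousOn ψ.symm ψ.target

/-- `M ⊆ ℝ^d` is a compact `n`-dimensional manifold with smooth local coordinates: it is compact
and covered by finitely many `n`-dimensional charts `ψ_j : V_j → ψ_j(V_j)` such that, for every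
`γ > 0`, `ψ_j` is `γ`-Hölder on `V_j` and its inverse is `γ`-Hölder on `ψ_j(V_j)`. -/
def IsCompactManifoldWithSmoothCoords {d : ℕ} (n : ℕ) (M : Set (Fin d → ℝ)) : Prop :=
  IsCompact M ∧
    ∃ (r : ℕ) (ψ : Fin r → PartialEquiv (Fin d → ℝ) (Fin n → ℝ)),
      (∀ j, IsChart M (ψ j)) ∧ (⋃ j, (ψ j).source) = M ∧
        ∀ γ : ℝ, 0 < γ → ∀ j,
          PolyHolder γ (ψ j).source (ψ j) ∧ PolyHolder γ (ψ j).target (ψ j).symm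

end DeepReLU

/-!
# Approximation of Hölder functions on a manifold by sparse ReLU networks

Since `f` is Hölder on all of `ℝ^d`, the charts are not needed inside the networks; the manifold
enters only through its covering numbers. Take the lattice `δ ℤ^d` with `δ` of order `η ^ (1 / β)`.
Charts and their inverses are Lipschitz, so only `O(δ ^ (-dstar))` lattice points have a hat function
whose support meets `M` (`IsCompactManifoldWithSmoothCoords.exists_lattice`). These hat functions
still form a partition of unity on `M` (`sum_prod_hat_eq_one`), and averaging the Taylor polynomials
of `f` with it approximates `f` on `M` up to `O(δ ^ β)` (`abs_sub_sum_localMonomial_le`). If each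
Taylor polynomial is centred at the lower corner of the support of its hat function, the average is a
linear combination of products of at most `d + k` numbers in `[0, 1]`, all of them piecewise linear
functions of one coordinate (`localMonomial`).

The Taylor polynomials are obtained by expanding in one coordinate after another, in the order in
which `multiDeriv` differentiates (`exists_taylor_list`); partial derivatives are never interchanged.

Products are computed through `u * v = ((u + v) / 2) ^ 2 - ((u - v) / 2) ^ 2` and the expansion of
`t * (1 - t)` into iterated tent maps, whose error after `m` steps is at most `4 ^ (-m)`
(`mul_one_sub_eq_sawSum_add`). A depth of order `log (1 / η)` therefore makes the error of every
summand small compared with `η` divided by the number of summands, and it also suffices to build the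
slope `1 / (2 * δ)` by repeated doubling with parameters in `[-1, 1]`. Every summand needs only
constant width (`exists_localMonomial`). Placing the summands in parallel, with block diagonal
matrices (`Computes.par`), gives the bounds on the width and on the number of non-zero parameters.
-/

namespace DeepReLU

/-! ### Layered maps and their parallel composition -/

/-- The number of non-zero entries of a vector over an arbitrary finite index type. -/
noncomputable def nnz {ι : Type} [Fintype ι] (v : ι → ℝ) : ℕ := ∑ i, if v i = 0 then 0 else 1

/-- The layer `y ↦ σ_v (W y)` over arbitrary finite index types. -/
noncomputable def layerMap {ι κ : Type} [Fintype ι] (W : κ → ι → ℝ) (v : κ → ℝ) (y : ι → ℝ) :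
    κ → ℝ :=
  fun k => max (∑ i, W k i * y i - v k) 0

/-- `Computes d L w s G` says that `G` is a composition of `L + 1` layers `σ_v W` on `ℝ^d`, all of
width at most `w`, with parameters in `[-1, 1]`, of which at most `s` are non-zero. The index types
of the layers are arbitrary, so that two such maps can be put side by side on a sum type. The
number of layers is `L + 1`, since the map without any layer cannot be put in parallel
with itself. -/
def Computes (d : ℕ) : (L w s : ℕ) → {κ : Type} → [Fintype κ] → ((Fin d → ℝ) → κ → ℝ) → Prop
  | 0, w, s, κ, _, G => Fintype.card κ ≤ w ∧ ∃ (W : κ → Fin d → ℝ) (v : κ → ℝ),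
      (∀ k i, |W k i| ≤ 1) ∧ (∀ k, |v k| ≤ 1) ∧ ∑ k, nnz (W k) + nnz v ≤ s ∧
      ∀ x, G x = layerMap W v x
  | L + 1, w, s, κ, _, G => Fintype.card κ ≤ w ∧ ∃ (ι : Type) (_ : Fintype ι) (s₀ : ℕ)
      (F : (Fin d → ℝ) → ι → ℝ) (W : κ → ι → ℝ) (v : κ → ℝ), Computes d L w s₀ F ∧
      (∀ k i, |W k i| ≤ 1) ∧ (∀ k, |v k| ≤ 1) ∧ s₀ + (∑ k, nnz (W k) + nnz v) ≤ s ∧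
      ∀ x, G x = layerMap W v (F x)

variable {d L w w' s s' : ℕ} {ι κ κ' : Type} [Fintype ι] [Fintype κ] [Fintype κ']

lemma nnz_le_card (v : ι → ℝ) : nnz v ≤ Fintype.card ι := by
  unfold nnz
  calc _ ≤ ∑ _i : ι, 1 := Finset.sum_le_sum fun i _ => by split_ifs <;> simp
    _ = _ := by simp

lemma sum_nnz_add_nnz_le {W : κ → ι → ℝ} {v : κ → ℝ} :
    ∑ k, nnz (W k) + nnz v ≤ Fintype.card κ * (Fintype.card ι + 1) := by
  have h1 : ∑ k, nnz (W k) ≤ ∑ _k : κ, Fintype.card ι :=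
    Finset.sum_le_sum fun k _ => nnz_le_card _
  have h2 := nnz_le_card v
  simp only [Finset.sum_const, Finset.card_univ, smul_eq_mul] at h1
  linarith

lemma nnz_zero : nnz (0 : ι → ℝ) = 0 := by simp [nnz]

lemma nnz_sumElim (v : κ → ℝ) (v' : κ' → ℝ) : nnz (Sum.elim v v') = nnz v + nnz v' :=
  Fintype.sum_sum_type _

lemma Computes.card_le {G : (Fin d → ℝ) → κ → ℝ} (h : Computes d L w s G) :
    Fintype.card κ ≤ w := by
  cases L <;> exact h.1

lemma Computes.nonneg {G : (Fin d → ℝ) → κ → ℝ} (h : Computes d L w s G) (x : Fin d → ℝ) (k : κ) :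
    0 ≤ G x k := by
  cases L with
  | zero => obtain ⟨_, W, v, _, _, _, h⟩ := h; rw [h]; exact le_max_right _ _
  | succ L => obtain ⟨_, _, _, _, _, W, v, _, _, _, _, h⟩ := h; rw [h]; exact le_max_right _ _

lemma Computes.mono {G : (Fin d → ℝ) → κ → ℝ} (h : Computes d L w s G) (hw : w ≤ w') :
    Computes d L w' s G := by
  induction L generalizing s κ with
  | zero => exact ⟨h.1.trans hw, h.2⟩
  | succ L ih =>
    obtain ⟨hc, ι, _, s₀, F, W, v, hF, hr⟩ := h
    exact ⟨hc.trans hw, ι, _, s₀, F, W, v, ih hF, hr⟩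

/-- The number of non-zero parameters is at most the number of all parameters. -/
lemma Computes.sparsity {G : (Fin d → ℝ) → κ → ℝ} (h : Computes d L w s G) :
    Computes d L w ((L + 1) * (w * (w + d + 1))) G := by
  induction L generalizing s κ with
  | zero =>
    obtain ⟨hc, W, v, hW, hv, _, hG⟩ := h
    refine ⟨hc, W, v, hW, hv, ?_, hG⟩
    refine sum_nnz_add_nnz_le.trans ?_
    simp only [Fintype.card_fin, zero_add, one_mul]
    exact Nat.mul_le_mul hc (by omega)
  | succ L ih =>
    obtain ⟨hc, ι, _, s₀, F, W, v, hF, hW, hv, _, hG⟩ := h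
    refine ⟨hc, ι, _, _, F, W, v, ih hF, hW, hv, ?_, hG⟩
    have h1 : Fintype.card κ * (Fintype.card ι + 1) ≤ w * (w + d + 1) :=
      Nat.mul_le_mul hc (by have := hF.card_le; omega)
    have h2 := sum_nnz_add_nnz_le (W := W) (v := v)
    calc _ ≤ (L + 1) * (w * (w + d + 1)) + w * (w + d + 1) := by omega
      _ = _ := by ring

/-- Two maps of the same depth side by side, by block diagonal weight matrices. -/
lemma Computes.par {F : (Fin d → ℝ) → κ → ℝ} {G : (Fin d → ℝ) → κ' → ℝ}
    (hF : Computes d L w s F) (hG : Computes d L w' s' G) :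
    Computes d L (w + w') (s + s') (fun x => Sum.elim (F x) (G x)) := by
  induction L generalizing s s' κ κ' with
  | zero =>
    obtain ⟨hc, W, v, hW, hv, hs, hF⟩ := hF
    obtain ⟨hc', W', v', hW', hv', hs', hG⟩ := hG
    refine ⟨by simp; omega, Sum.elim W W', Sum.elim v v', ?_, ?_, ?_, ?_⟩
    · rintro (k | k) i <;> simp [hW, hW']
    · rintro (k | k) <;> simp [hv, hv']
    · simp only [nnz_sumElim, Fintype.sum_sum_type, Sum.elim_inl, Sum.elim_inr]; omega
    · intro x; funext k; rcases k with k | k <;> simp [hF, hG, layerMap]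
  | succ L ih =>
    obtain ⟨hc, ι, _, s₀, F₀, W, v, hF₀, hW, hv, hs, hF⟩ := hF
    obtain ⟨hc', ι', _, s₀', G₀, W', v', hG₀, hW', hv', hs', hG⟩ := hG
    refine ⟨by simp; omega, ι ⊕ ι', inferInstance, s₀ + s₀', _,
      Sum.elim (fun k => Sum.elim (W k) 0) (fun k => Sum.elim 0 (W' k)), Sum.elim v v',
      ih hF₀ hG₀, ?_, ?_, ?_, ?_⟩
    · rintro (k | k) (i | i) <;> simp [hW, hW']
    · rintro (k | k) <;> simp [hv, hv']
    · simp only [nnz_sumElim, Fintype.sum_sum_type, Sum.elim_inl, Sum.elim_inr, nnz_zero]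
      simp only [add_zero, zero_add]; omega
    · intro x; funext k; rcases k with k | k <;> simp [hF, hG, layerMap]

/-! ### Realization by networks -/

lemma sum_extend_zero {p : ℕ} (e : κ ↪ Fin p) (g : κ → ℝ) {A : Type*} [AddCommMonoid A]
    (Φ : Fin p → ℝ → A) (h0 : ∀ a, Φ a 0 = 0) :
    ∑ a, Φ a (Function.extend e g 0 a) = ∑ k, Φ (e k) (g k) := by
  classical
  rw [← Finset.sum_subset (Finset.subset_univ (Finset.univ.map e)), Finset.sum_map]
  · exact Finset.sum_congr rfl fun k _ => by rw [e.injective.extend_apply]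
  · intro a _ ha
    rw [Function.extend_apply', Pi.zero_apply, h0]
    rintro ⟨k, rfl⟩
    exact ha (by simp)

lemma nnz_extend {p : ℕ} (e : κ ↪ Fin p) (g : κ → ℝ) : nnz (Function.extend e g 0) = nnz g :=
  sum_extend_zero e g (fun _ y => if y = 0 then 0 else 1) (by simp)

lemma vecNonzero_eq_nnz {n : ℕ} (v : Fin n → ℝ) : vecNonzero v = nnz v := by
  rw [vecNonzero, Finset.card_filter, nnz]
  exact Finset.sum_congr rfl fun i _ => by by_cases h : v i = 0 <;> simp [h]

lemma matNonzero_eq_sum_nnz {m n : ℕ} (W : Matrix (Fin m) (Fin n) ℝ) :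
    matNonzero W = ∑ k, nnz (W k) := by
  rw [matNonzero, Finset.card_filter, Fintype.sum_prod_type]
  refine Finset.sum_congr rfl fun k _ => ?_
  exact Finset.sum_congr rfl fun i _ => by by_cases h : W k i = 0 <;> simp [h]

/-- A matrix with zero rows added, along an embedding of its row indices. -/
noncomputable def extendRows {n p : ℕ} (e : κ ↪ Fin p) (W : κ → Fin n → ℝ) :
    Matrix (Fin p) (Fin n) ℝ :=
  fun a b => Function.extend e (fun k => W k b) 0 a

lemma extendRows_apply {κ : Type} {n p : ℕ} (e : κ ↪ Fin p) (W : κ → Fin n → ℝ) (k : κ) :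
    extendRows e W (e k) = W k := by
  funext b; exact e.injective.extend_apply _ _ _

lemma extendRows_eq_zero {κ : Type} {n p : ℕ} (e : κ ↪ Fin p) (W : κ → Fin n → ℝ) {a : Fin p}
    (ha : ¬ ∃ k, e k = a) : extendRows e W a = 0 := by
  funext b; exact Function.extend_apply' _ _ _ ha

lemma matNonzero_extendRows {n p : ℕ} (e : κ ↪ Fin p) (W : κ → Fin n → ℝ) :
    matNonzero (extendRows e W) = ∑ k, nnz (W k) := by
  classical
  rw [matNonzero_eq_sum_nnz, ← Finset.sum_subset (Finset.subset_univ (Finset.univ.map e)),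
    Finset.sum_map]
  · exact Finset.sum_congr rfl fun k _ => by rw [extendRows_apply]
  · intro a _ ha
    rw [extendRows_eq_zero, nnz_zero]
    rintro ⟨k, rfl⟩
    exact ha (by simp)

lemma abs_extend_le_one {p : ℕ} (e : κ ↪ Fin p) {g : κ → ℝ} (hg : ∀ k, |g k| ≤ 1) (a : Fin p) :
    |Function.extend e g 0 a| ≤ 1 := by
  by_cases ha : ∃ k, e k = a
  · obtain ⟨k, rfl⟩ := ha
    rw [e.injective.extend_apply]; exact hg k
  · rw [Function.extend_apply' _ _ _ ha]; simp

lemma shiftedReLU_extend {n p : ℕ} (e : κ ↪ Fin p) (W : κ → Fin n → ℝ) (v : κ → ℝ)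
    (y : Fin n → ℝ) : shiftedReLU (Function.extend e v 0) ((extendRows e W).mulVec y) =
      Function.extend e (layerMap W v y) 0 := by
  funext a
  by_cases ha : ∃ k, e k = a
  · obtain ⟨k, rfl⟩ := ha
    simp only [shiftedReLU, Matrix.mulVec, dotProduct, extendRows_apply,
      e.injective.extend_apply, layerMap]
  · simp [shiftedReLU, Matrix.mulVec, dotProduct, extendRows_eq_zero e W ha,
      Function.extend_apply' _ _ _ ha]

/-- A map given by layers can be prepended to a network. The outputs are placed in `Fin p` along an
arbitrary embedding, with zeros elsewhere. -/
lemma Computes.exists_network {p : ℕ} {G : (Fin d → ℝ) → κ → ℝ} (h : Computes d L w s G)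
    (hw : w ≤ p) (e : κ ↪ Fin p) {q : ℕ} {hs hs' : List ℕ} (N : Network p hs q)
    (hN : N.BoundedByOne) (hhs : hs' = List.replicate (L + 1) p ++ hs) :
    ∃ N' : Network d hs' q, N'.BoundedByOne ∧ N'.numNonzero ≤ s + N.numNonzero ∧
      ∀ x, N'.eval x = N.eval (Function.extend e (G x) 0) := by
  induction L generalizing s κ hs hs' with
  | zero =>
    obtain ⟨_, W, v, hW, hv, hs, hG⟩ := h
    subst hhs
    refine ⟨.layer (extendRows e W) (Function.extend e v 0) N,
      ⟨fun a b => abs_extend_le_one e (fun k => hW k b) a, abs_extend_le_one e hv, hN⟩, ?_, ?_⟩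
    · simp only [Network.numNonzero, matNonzero_extendRows, vecNonzero_eq_nnz, nnz_extend]
      omega
    · intro x
      rw [hG, ← shiftedReLU_extend]
      rfl
  | succ L ih =>
    obtain ⟨_, ι, _, s₀, F, W, v, hF, hW, hv, hs, hG⟩ := h
    obtain ⟨e'⟩ : Nonempty (ι ↪ Fin p) := Function.Embedding.nonempty_of_card_le
      (by simpa using hF.card_le.trans hw)
    have key := ih hF e' (.layer (extendRows e fun k => Function.extend e' (W k) 0)
      (Function.extend e v 0) N)
      ⟨fun a b => abs_extend_le_one e (fun k => abs_extend_le_one e' (hW k) b) a,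
        abs_extend_le_one e hv, hN⟩ (hs' := hs')
      (by rw [hhs, List.replicate_succ', List.append_assoc]; rfl)
    obtain ⟨N', hN', hs', hE⟩ := key
    refine ⟨N', hN', ?_, ?_⟩
    · simp only [Network.numNonzero, matNonzero_extendRows, vecNonzero_eq_nnz, nnz_extend] at hs'
      omega
    · intro x
      rw [hE, hG]
      simp only [Network.eval, shiftedReLU_extend]
      congr 2
      funext k
      simp only [layerMap]
      congr 2
      exact (sum_extend_zero e' (F x) (fun b y => Function.extend e' (W k) 0 b * y)
        (by simp)).trans (by simp [e'.injective.extend_apply])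

/-- `LinearReadout d L w s h` says that `h` is a linear functional with coefficients in `[-1, 1]`
of the outputs of some map in `Computes d L w _`, with at most `s` non-zero parameters in total. -/
def LinearReadout (d L w s : ℕ) (h : (Fin d → ℝ) → ℝ) : Prop :=
  ∃ (κ : Type) (_ : Fintype κ) (s₀ : ℕ) (G : (Fin d → ℝ) → κ → ℝ) (a : κ → ℝ),
    Computes d L w s₀ G ∧ (∀ k, |a k| ≤ 1) ∧ s₀ + Fintype.card κ ≤ s ∧ ∀ x, h x = ∑ k, a k * G x k

lemma LinearReadout.mono {h : (Fin d → ℝ) → ℝ} (hh : LinearReadout d L w s h)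
    (hw : w ≤ w') (hs : s ≤ s') : LinearReadout d L w' s' h := by
  obtain ⟨κ, _, s₀, G, a, hG, ha, hc, hE⟩ := hh
  exact ⟨κ, _, s₀, G, a, hG.mono hw, ha, hc.trans hs, hE⟩

lemma LinearReadout.add {g h : (Fin d → ℝ) → ℝ} (hg : LinearReadout d L w s g)
    (hh : LinearReadout d L w' s' h) :
    LinearReadout d L (w + w') (s + s') (fun x => g x + h x) := by
  obtain ⟨κ, _, s₀, G, a, hG, ha, hc, hE⟩ := hg
  obtain ⟨κ', _, s₀', G', a', hG', ha', hc', hE'⟩ := hh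
  refine ⟨κ ⊕ κ', inferInstance, _, _, Sum.elim a a', hG.par hG', ?_, ?_, ?_⟩
  · rintro (k | k) <;> simp [ha, ha']
  · simp; omega
  · intro x; simp [hE, hE']

lemma computes_empty (d L : ℕ) : Computes d L 0 0 (fun _ => (Empty.elim : Empty → ℝ)) := by
  induction L with
  | zero => exact ⟨by simp, Empty.elim, Empty.elim, by simp, by simp, by simp [nnz], by
      intro x; funext k; exact k.elim⟩
  | succ L ih => exact ⟨by simp, Empty, inferInstance, 0, _, Empty.elim, Empty.elim, ih, by simp,
      by simp, by simp [nnz], by intro x; funext k; exact k.elim⟩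

lemma linearReadout_zero (d L : ℕ) : LinearReadout d L 0 0 (fun _ => 0) :=
  ⟨Empty, inferInstance, 0, _, Empty.elim, computes_empty d L, by simp, by simp, by simp⟩

lemma LinearReadout.sum {I : Type*} (S : Finset I) {h : I → (Fin d → ℝ) → ℝ}
    (hh : ∀ i ∈ S, LinearReadout d L w s (h i)) :
    LinearReadout d L (S.card * w) (S.card * s) (fun x => ∑ i ∈ S, h i x) := by
  classical
  induction S using Finset.induction_on with
  | empty => simpa using linearReadout_zero d L
  | insert i S hi ih =>
    have h1 := (hh i (by simp)).add (ih fun j hj => hh j (by simp [hj]))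
    simp only [Finset.sum_insert hi, Finset.card_insert_of_notMem hi]
    exact h1.mono (by linarith) (by linarith)

/-- A linear readout of `L + 1` layers is a network with `L + 1` hidden layers. -/
lemma LinearReadout.exists_uniformClass {p : ℕ} {h : (Fin d → ℝ) → ℝ}
    (hh : LinearReadout d L w s h) (hw : w ≤ p) :
    ∃ g ∈ uniformClass (L + 1) d p 1 s, ∀ x, g x 0 = h x := by
  obtain ⟨κ, _, s₀, G, a, hG, ha, hc, hE⟩ := hh
  obtain ⟨e⟩ : Nonempty (κ ↪ Fin p) := Function.Embedding.nonempty_of_card_le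
    (by simpa using hG.card_le.trans hw)
  obtain ⟨N, hN, hs, hNe⟩ := hG.exists_network hw e
    (.out (fun (_ : Fin 1) => Function.extend e a 0) : Network p [] 1)
    (fun _ => abs_extend_le_one e ha) (List.append_nil _).symm
  refine ⟨N.eval, ⟨N, hN, hs.trans ?_, rfl⟩, fun x => ?_⟩
  · have h1 : (Network.out (fun (_ : Fin 1) => Function.extend e a 0) :
        Network p [] 1).numNonzero = nnz a := by
      refine (matNonzero_eq_sum_nnz _).trans ?_
      rw [Finset.univ_unique, Finset.sum_singleton, nnz_extend]
    have := nnz_le_card a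
    omega
  · rw [hNe, hE]
    simp only [Network.eval, Matrix.mulVec, dotProduct]
    exact (sum_extend_zero e (G x) (fun b y => Function.extend e a 0 b * y)
        (by simp)).trans (by simp [e.injective.extend_apply])

/-! ### Approximate multiplication -/

/-- The `k`-th iterate of the tent map on `[0, 1]`, divided by `4 ^ k`. The rescaling keeps all
coefficients in `[-1, 1]`. -/
noncomputable def saw : ℕ → ℝ → ℝ
  | 0, t => t
  | k + 1, t => max (saw k t / 2 - max (saw k t - 1 / (2 * 4 ^ k)) 0) 0

/-- The partial sums of the expansion `t * (1 - t) = ∑ k ≥ 1, saw k t`. -/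
noncomputable def sawSum (m : ℕ) (t : ℝ) : ℝ := ∑ k ∈ Finset.range m, saw (k + 1) t

lemma saw_nonneg {t : ℝ} (ht : 0 ≤ t) (k : ℕ) : 0 ≤ saw k t := by
  cases k
  · exact ht
  · exact le_max_right _ _

lemma sawSum_nonneg (m : ℕ) (t : ℝ) : 0 ≤ sawSum m t :=
  Finset.sum_nonneg fun _ _ => le_max_right _ _

lemma saw_le {t : ℝ} (h1 : t ≤ 1) (k : ℕ) : saw k t ≤ 1 / 4 ^ k := by
  induction k with
  | zero => simpa [saw] using h1
  | succ k ih =>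
    have hp : (0 : ℝ) < 4 ^ k := by positivity
    have e1 : (1 : ℝ) / (2 * 4 ^ k) = 1 / 4 ^ k / 2 := by field_simp
    have e2 : (1 : ℝ) / 4 ^ (k + 1) = 1 / 4 ^ k / 4 := by rw [pow_succ]; field_simp
    have hq : (0 : ℝ) < 1 / 4 ^ k := by positivity
    simp only [saw, e1, e2]
    refine max_le ?_ (by positivity)
    rcases le_total (saw k t) (1 / 4 ^ k / 2) with h | h
    · have := le_max_right (saw k t - 1 / 4 ^ k / 2) 0; linarith
    · have := le_max_left (saw k t - 1 / 4 ^ k / 2) 0; linarith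

/-- The exact remainder of the expansion of `t * (1 - t)`: the tent map `T` satisfies
`s (1 - s) = (T s + T s (1 - T s)) / 4`. -/
lemma mul_one_sub_eq_sawSum_add {t : ℝ} (h0 : 0 ≤ t) (h1 : t ≤ 1) (m : ℕ) :
    t * (1 - t) = sawSum m t + saw m t * (1 - 4 ^ m * saw m t) := by
  induction m with
  | zero => simp [sawSum, saw]
  | succ m ih =>
    rw [ih, sawSum, sawSum, Finset.sum_range_succ, add_assoc]
    congr 1
    have hs0 := saw_nonneg h0 m
    have hs1 := saw_le h1 m
    obtain ⟨c, hc⟩ : ∃ c : ℝ, c = 1 / (2 * 4 ^ m) := ⟨_, rfl⟩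
    have hc0 : 0 < c := by rw [hc]; positivity
    have e1 : (4 : ℝ) ^ m = 1 / (2 * c) := by rw [hc]; field_simp
    have hs1' : saw m t ≤ 2 * c := by rw [e1] at hs1; simpa using hs1
    have hS : saw (m + 1) t = max (saw m t / 2 - max (saw m t - c) 0) 0 := by rw [saw, hc]
    rw [hS, pow_succ, e1]
    rcases le_total (saw m t) c with h | h
    · rw [max_eq_right (by linarith : saw m t - c ≤ 0), max_eq_left (by linarith)]
      field_simp; ring
    · rw [max_eq_left (by linarith : 0 ≤ saw m t - c), max_eq_left (by linarith)]
      field_simp; ring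

lemma sawSum_approx {t : ℝ} (h0 : 0 ≤ t) (h1 : t ≤ 1) (m : ℕ) :
    0 ≤ t * (1 - t) - sawSum m t ∧ t * (1 - t) - sawSum m t ≤ 1 / 4 ^ m := by
  have h := mul_one_sub_eq_sawSum_add h0 h1 m
  have hs0 := saw_nonneg h0 m
  have hs1 := saw_le h1 m
  have hp : (0 : ℝ) < 4 ^ m := by positivity
  have h2 : 4 ^ m * saw m t ≤ 1 := by
    rw [le_div_iff₀ hp] at hs1; linarith
  have h3 : 0 ≤ 4 ^ m * saw m t := by positivity
  constructor
  · have := mul_nonneg hs0 (by linarith : 0 ≤ 1 - 4 ^ m * saw m t); linarith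
  · have := mul_le_mul_of_nonneg_left (by linarith : 1 - 4 ^ m * saw m t ≤ 1) hs0; linarith

/-- The polarization `u * v = ((u + v) / 2) ^ 2 - ((u - v) / 2) ^ 2`, with both squares expanded. -/
lemma abs_sawSum_sub_mul_le {u v : ℝ} (hu0 : 0 ≤ u) (hu1 : u ≤ 1) (hv0 : 0 ≤ v) (hv1 : v ≤ 1)
    (m : ℕ) : |((u + v) / 2 - |u - v| / 2 + sawSum m (|u - v| / 2)) - sawSum m ((u + v) / 2)
      - u * v| ≤ 1 / 4 ^ m := by
  have ha := sawSum_approx (t := (u + v) / 2) (by linarith) (by linarith) m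
  have hab : |u - v| ≤ 1 := abs_le.2 ⟨by linarith, by linarith⟩
  have hb := sawSum_approx (t := |u - v| / 2) (by positivity) (by linarith) m
  have hsq : |u - v| * |u - v| = (u - v) * (u - v) := abs_mul_abs_self _
  rw [abs_le]
  constructor <;> nlinarith

/-- `G` is computed by `L + 1` layers of width at most `w` with parameters in `[-1, 1]`. -/
def LayerComputable (d L w : ℕ) {κ : Type} [Fintype κ] (G : (Fin d → ℝ) → κ → ℝ) : Prop :=
  ∃ s, Computes d L w s G

/-- The scalar function `g` is computed by `L + 1` layers of width at most `w`. -/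
def ScalarComputable (d L w : ℕ) (g : (Fin d → ℝ) → ℝ) : Prop :=
  LayerComputable d L w (fun x (_ : Unit) => g x)

lemma LayerComputable.mono {G : (Fin d → ℝ) → κ → ℝ} (h : LayerComputable d L w G) (hw : w ≤ w') :
    LayerComputable d L w' G := h.imp fun _ h => h.mono hw

lemma LayerComputable.step {F : (Fin d → ℝ) → ι → ℝ} {G : (Fin d → ℝ) → κ → ℝ}
    (h : LayerComputable d L w F) (W : κ → ι → ℝ) (v : κ → ℝ) (hc : Fintype.card κ ≤ w)
    (hW : ∀ k i, |W k i| ≤ 1) (hv : ∀ k, |v k| ≤ 1) (hG : ∀ x, G x = layerMap W v (F x)) :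
    LayerComputable d (L + 1) w G := by
  obtain ⟨s, h⟩ := h
  exact ⟨_, hc, ι, _, s, F, W, v, h, hW, hv, le_rfl, hG⟩

lemma LayerComputable.of_input {G : (Fin d → ℝ) → κ → ℝ} (W : κ → Fin d → ℝ) (v : κ → ℝ)
    (hc : Fintype.card κ ≤ w) (hW : ∀ k i, |W k i| ≤ 1) (hv : ∀ k, |v k| ≤ 1)
    (hG : ∀ x, G x = layerMap W v x) : LayerComputable d 0 w G :=
  ⟨_, hc, W, v, hW, hv, le_rfl, hG⟩

lemma ScalarComputable.mono {g : (Fin d → ℝ) → ℝ} (h : ScalarComputable d L w g) (hw : w ≤ w') :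
    ScalarComputable d L w' g := LayerComputable.mono h hw

lemma ScalarComputable.nonneg {g : (Fin d → ℝ) → ℝ} (h : ScalarComputable d L w g)
    (x : Fin d → ℝ) : 0 ≤ g x := by
  obtain ⟨s, h⟩ := h
  exact h.nonneg x ()

lemma ScalarComputable.one_le {g : (Fin d → ℝ) → ℝ} (h : ScalarComputable d L w g) : 1 ≤ w := by
  obtain ⟨s, h⟩ := h
  simpa using h.card_le

/-- Networks can be deepened, since the outputs are fixed points of the activation. -/
lemma ScalarComputable.deepen {g : (Fin d → ℝ) → ℝ} (h : ScalarComputable d L w g) {L' : ℕ}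
    (hL : L ≤ L') : ScalarComputable d L' w g := by
  obtain ⟨k, rfl⟩ := Nat.exists_eq_add_of_le hL
  induction k with
  | zero => exact h
  | succ k ih =>
    have ih := ih (by omega)
    refine LayerComputable.step ih (fun _ _ => 1) (fun _ => 0) (by simpa using h.one_le)
      (by simp) (by simp) fun x => ?_
    funext _
    simp [layerMap, h.nonneg x]

lemma scalarComputable_one (d L : ℕ) : ScalarComputable d L 1 (fun _ => 1) := by
  have h : ScalarComputable d 0 1 (fun _ => 1) :=
    LayerComputable.of_input (fun _ _ => 0) (fun _ => -1) (by simp) (by simp) (by simp) fun x => by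
      funext _; simp [layerMap]
  exact h.deepen (Nat.zero_le _)

/-- Clipping at `1` takes two layers. -/
lemma ScalarComputable.min_one {g : (Fin d → ℝ) → ℝ}
    {F : (Fin d → ℝ) → ι → ℝ} (h : LayerComputable d L w F) (hw : 1 ≤ w) (a : ι → ℝ)
    (ha : ∀ i, |a i| ≤ 1) (hg : ∀ x, g x = min (∑ i, a i * F x i) 1)
    (hg0 : ∀ x, 0 ≤ ∑ i, a i * F x i) :
    ScalarComputable d (L + 2) w g := by
  have h1 : ScalarComputable d (L + 1) w (fun x => max (1 - ∑ i, a i * F x i) 0) := by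
    refine LayerComputable.step h (fun _ i => - a i) (fun _ => -1) (by simpa using hw)
      (by simpa using ha) (by simp) fun x => ?_
    funext _
    simp [layerMap, ← sub_eq_neg_add]
  refine LayerComputable.step h1 (fun _ _ => -1) (fun _ => -1) (by simpa using hw)
      (by simp) (by simp) fun x => ?_
  funext _
  have := hg0 x
  simp only [layerMap, hg, Finset.univ_unique, Finset.sum_singleton]
  rcases le_total (∑ i, a i * F x i) 1 with h | h
  · rw [min_eq_left h, max_eq_left (a := 1 - _) (by linarith), max_eq_left (by linarith)]; ring
  · rw [min_eq_right h, max_eq_right (a := 1 - _) (by linarith), max_eq_left (by linarith)]; ring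

/-- The network that computes `sawSum` at `(u + v) / 2` and at `|u - v| / 2` simultaneously. -/
lemma layerComputable_saw {u v : (Fin d → ℝ) → ℝ} (hu : ScalarComputable d L w u)
    (hv : ScalarComputable d L w' v) (m : ℕ) :
    LayerComputable d (L + 2 + 3 * m) (max (w + w') 6) (fun x => ![saw m ((u x + v x) / 2),
      saw m (|u x - v x| / 2), (u x + v x) / 2 - |u x - v x| / 2 + sawSum m (|u x - v x| / 2),
      sawSum m ((u x + v x) / 2)]) := by
  have hmin : ∀ x, 0 ≤ (u x + v x) / 2 - |u x - v x| / 2 := fun x => by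
    have h1 := hu.nonneg x
    have h2 := hv.nonneg x
    rcases abs_cases (u x - v x) with h | h <;> linarith
  have hab : ∀ x, 0 ≤ (u x + v x) / 2 := fun x => by
    have h1 := hu.nonneg x
    have h2 := hv.nonneg x
    linarith
  induction m with
  | zero =>
    obtain ⟨s, hu'⟩ := hu
    obtain ⟨s', hv'⟩ := hv
    have h0 : LayerComputable d L (max (w + w') 6) _ := ⟨_, (hu'.par hv').mono (le_max_left _ _)⟩
    have h1 : LayerComputable d (L + 1) (max (w + w') 6) (fun x => ![(u x + v x) / 2,
        max ((u x - v x) / 2) 0, max ((v x - u x) / 2) 0]) := by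
      refine h0.step ![Sum.elim (fun _ => 1 / 2) (fun _ => 1 / 2),
        Sum.elim (fun _ => 1 / 2) (fun _ => -1 / 2), Sum.elim (fun _ => -1 / 2) (fun _ => 1 / 2)]
        ![0, 0, 0] (by simp) ?_ ?_ fun x => ?_
      · intro k i; fin_cases k <;> rcases i with i | i <;> norm_num [abs_le]
      · intro k; fin_cases k <;> simp
      · funext k
        fin_cases k
        · simp [layerMap]
          rw [max_eq_left] <;> linarith [hab x]
        · simp [layerMap]; congr 1; ring
        · simp [layerMap]; congr 1; ring
    refine h1.step ![![1, 0, 0], ![0, 1, 1], ![1, -1, -1], ![0, 0, 0]] ![0, 0, 0, 0] (by simp)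
      ?_ ?_ fun x => ?_
    · intro k i; fin_cases k <;> fin_cases i <;> simp
    · intro k; fin_cases k <;> simp
    · have hmax : |u x - v x| / 2 = max ((u x - v x) / 2) 0 + max ((v x - u x) / 2) 0 := by
        rcases le_total (u x) (v x) with h | h
        · rw [abs_of_nonpos (by linarith), max_eq_right (by linarith), max_eq_left (by linarith)]
          ring
        · rw [abs_of_nonneg (by linarith), max_eq_left (by linarith), max_eq_right (by linarith)]
          ring
      have h1 := hmin x
      rw [hmax] at h1 ⊢
      funext k
      fin_cases k
      · simp [layerMap, Fin.sum_univ_three, saw, hab x]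
      · simp [layerMap, Fin.sum_univ_three, saw]
        positivity
      · simp [layerMap, Fin.sum_univ_three, sawSum]
        rw [max_eq_left (a := _ + _)] <;> linarith
      · simp [layerMap, Fin.sum_univ_three, sawSum]
  | succ m ih =>
    have hc : |1 / (2 * 4 ^ m : ℝ)| ≤ 1 := by
      rw [abs_of_pos (by positivity), div_le_one (by positivity)]
      have : (1 : ℝ) ≤ 4 ^ m := one_le_pow₀ (by norm_num)
      linarith
    have ha0 : ∀ x, 0 ≤ saw m ((u x + v x) / 2) := fun x => saw_nonneg (hab x) m
    have hb0 : ∀ x, 0 ≤ saw m (|u x - v x| / 2) := fun x => saw_nonneg (by positivity) m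
    have hA0 : ∀ m x, 0 ≤ (u x + v x) / 2 - |u x - v x| / 2 + sawSum m (|u x - v x| / 2) :=
      fun m x => add_nonneg (hmin x) (sawSum_nonneg _ _)
    have h1 : LayerComputable d (L + 2 + 3 * m + 1) (max (w + w') 6) (fun x =>
        ![saw m ((u x + v x) / 2) / 2, max (saw m ((u x + v x) / 2) - 1 / (2 * 4 ^ m)) 0,
          saw m (|u x - v x| / 2) / 2, max (saw m (|u x - v x| / 2) - 1 / (2 * 4 ^ m)) 0,
          (u x + v x) / 2 - |u x - v x| / 2 + sawSum m (|u x - v x| / 2),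
          sawSum m ((u x + v x) / 2)]) := by
      refine ih.step ![![1 / 2, 0, 0, 0], ![1, 0, 0, 0], ![0, 1 / 2, 0, 0], ![0, 1, 0, 0],
        ![0, 0, 1, 0], ![0, 0, 0, 1]] ![0, 1 / (2 * 4 ^ m), 0, 1 / (2 * 4 ^ m), 0, 0] (by simp)
        ?_ ?_ fun x => ?_
      · intro k i; fin_cases k <;> fin_cases i <;> norm_num [abs_le]
      · intro k; fin_cases k <;> first | exact hc | simp
      · funext k
        fin_cases k
        · simp [layerMap, Fin.sum_univ_four]
          rw [max_eq_left] <;> linarith [ha0 x]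
        · simp [layerMap, Fin.sum_univ_four]
        · simp [layerMap, Fin.sum_univ_four]
          rw [max_eq_left] <;> linarith [hb0 x]
        · simp [layerMap, Fin.sum_univ_four]
        · simp [layerMap, Fin.sum_univ_four]
          linarith [hA0 m x]
        · simp [layerMap, Fin.sum_univ_four, sawSum_nonneg]
    have h2 : LayerComputable d (L + 2 + 3 * m + 2) (max (w + w') 6) (fun x =>
        ![saw (m + 1) ((u x + v x) / 2), saw (m + 1) (|u x - v x| / 2),
          (u x + v x) / 2 - |u x - v x| / 2 + sawSum m (|u x - v x| / 2),
          sawSum m ((u x + v x) / 2)]) := by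
      refine h1.step ![![1, -1, 0, 0, 0, 0], ![0, 0, 1, -1, 0, 0], ![0, 0, 0, 0, 1, 0],
        ![0, 0, 0, 0, 0, 1]] ![0, 0, 0, 0] (by simp) ?_ ?_ fun x => ?_
      · intro k i; fin_cases k <;> fin_cases i <;> norm_num [abs_le]
      · intro k; fin_cases k <;> simp
      · funext k
        fin_cases k
        · simp [layerMap, Fin.sum_univ_six, saw, sub_eq_add_neg]
        · simp [layerMap, Fin.sum_univ_six, saw, sub_eq_add_neg]
        · simp [layerMap, Fin.sum_univ_six]
          linarith [hA0 m x]
        · simp [layerMap, Fin.sum_univ_six, sawSum_nonneg]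
    refine h2.step ![![1, 0, 0, 0], ![0, 1, 0, 0], ![0, 1, 1, 0], ![1, 0, 0, 1]] ![0, 0, 0, 0]
        (by simp) ?_ ?_ fun x => ?_
    · intro k i; fin_cases k <;> fin_cases i <;> norm_num [abs_le]
    · intro k; fin_cases k <;> simp
    · have e : ∀ t, sawSum (m + 1) t = sawSum m t + saw (m + 1) t := fun t =>
        Finset.sum_range_succ _ _
      have ha1 : 0 ≤ saw (m + 1) ((u x + v x) / 2) := saw_nonneg (hab x) _
      have hb1 : 0 ≤ saw (m + 1) (|u x - v x| / 2) := saw_nonneg (by positivity) _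
      have := hA0 m x
      have := sawSum_nonneg m ((u x + v x) / 2)
      funext k
      fin_cases k
      · simp [layerMap, Fin.sum_univ_four, ha1]
      · simp [layerMap, Fin.sum_univ_four, hb1]
      · simp [layerMap, Fin.sum_univ_four, e]
        rw [max_eq_left] <;> linarith
      · simp [layerMap, Fin.sum_univ_four, e]
        rw [max_eq_left] <;> linarith

/-- Approximate multiplication of two computed functions with values in `[0, 1]`. -/
lemma ScalarComputable.exists_mul {u v : (Fin d → ℝ) → ℝ} (hu : ScalarComputable d L w u)
    (hv : ScalarComputable d L w' v) (hu1 : ∀ x, u x ≤ 1) (hv1 : ∀ x, v x ≤ 1) (m : ℕ) :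
    ∃ g, ScalarComputable d (L + (3 * m + 5)) (max (w + w') 6) g ∧ (∀ x, g x ≤ 1) ∧
      ∀ x, |g x - u x * v x| ≤ 1 / 4 ^ m := by
  set A : (Fin d → ℝ) → ℝ :=
    fun x => (u x + v x) / 2 - |u x - v x| / 2 + sawSum m (|u x - v x| / 2) with hA
  set B : (Fin d → ℝ) → ℝ := fun x => sawSum m ((u x + v x) / 2) with hB
  have h1 : ScalarComputable d (L + 2 + 3 * m + 1) (max (w + w') 6)
      (fun x => max (A x - B x) 0) := by
    refine (layerComputable_saw hu hv m).step (fun _ => ![0, 0, 1, -1]) (fun _ => 0) (by simp)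
      ?_ (by simp) fun x => ?_
    · intro _ i; fin_cases i <;> simp
    · funext _
      simp [layerMap, Fin.sum_univ_four, hA, hB, sub_eq_add_neg]
  refine ⟨fun x => min (max (A x - B x) 0) 1, ?_, fun x => min_le_right _ _, fun x => ?_⟩
  · have h2 : ScalarComputable d (L + 2 + 3 * m + 1 + 2) (max (w + w') 6)
        (fun x => min (max (A x - B x) 0) 1) :=
      ScalarComputable.min_one h1 (le_trans (by norm_num) (le_max_right _ _)) (fun _ => 1)
        (by simp) (by simp) (by simp)
    convert h2 using 1
    ring
  · have h := abs_sawSum_sub_mul_le (hu.nonneg x) (hu1 x) (hv.nonneg x) (hv1 x) m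
    have h0 : 0 ≤ u x * v x := mul_nonneg (hu.nonneg x) (hv.nonneg x)
    have h1 : u x * v x ≤ 1 := mul_le_one₀ (hu1 x) (hv.nonneg x) (hv1 x)
    change |A x - B x - u x * v x| ≤ _ at h
    refine le_trans ?_ h
    change |min (max (A x - B x) 0) 1 - u x * v x| ≤ _
    rcases le_total (A x - B x) 0 with h2 | h2
    · rw [max_eq_right h2, min_eq_left zero_le_one, abs_of_nonpos (by linarith),
        abs_of_nonpos (by linarith)]
      linarith
    · rw [max_eq_left h2]
      rcases le_total (A x - B x) 1 with h3 | h3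
      · rw [min_eq_left h3]
      · rw [min_eq_right h3, abs_of_nonneg (by linarith), abs_of_nonneg (by linarith)]
        linarith

/-- Approximate multiplication of finitely many computed functions with values in `[0, 1]`. -/
lemma exists_list_prod (l : List ((Fin d → ℝ) → ℝ)) (hl : ∀ y ∈ l, ScalarComputable d L w y)
    (hl1 : ∀ y ∈ l, ∀ x, y x ≤ 1) (m : ℕ) :
    ∃ g, ScalarComputable d (L + l.length * (3 * m + 5)) (w * l.length + 6) g ∧
      (∀ x, g x ≤ 1) ∧ ∀ x, |g x - (l.map fun y => y x).prod| ≤ l.length * (1 / 4 ^ m) := by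
  induction l with
  | nil => exact ⟨fun _ => 1, (scalarComputable_one d _).mono (by simp), by simp, by simp⟩
  | cons y l ih =>
    obtain ⟨g, hg, hg1, hgl⟩ := ih (fun z hz => hl z (by simp [hz]))
      (fun z hz => hl1 z (by simp [hz]))
    have hy := hl y (by simp)
    have hy1 := hl1 y (by simp)
    obtain ⟨h, hh, hh1, hhe⟩ := (hy.deepen (Nat.le_add_right L _)).exists_mul hg hy1 hg1 m
    refine ⟨h, ?_, hh1, fun x => ?_⟩
    · have e : L + (y :: l).length * (3 * m + 5) =
          L + l.length * (3 * m + 5) + (3 * m + 5) := by simp; ring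
      rw [e]
      refine hh.mono (max_le ?_ (by omega))
      simp only [List.length_cons]
      linarith
    · have h1 := abs_sub_le (h x) (y x * g x) (y x * (l.map fun y => y x).prod)
      have h2 : |y x * g x - y x * (l.map fun y => y x).prod| ≤ l.length * (1 / 4 ^ m) := by
        rw [← mul_sub, abs_mul, abs_of_nonneg (hy.nonneg x)]
        exact (mul_le_of_le_one_left (abs_nonneg _) (hy1 x)).trans (hgl x)
      have h3 := hhe x
      simp only [List.map_cons, List.prod_cons, List.length_cons]
      push_cast
      linarith

/-! ### Local monomials -/

/-- The increasing piecewise linear function from `0` at `a` to `1` at `a + 2 * δ`. -/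
noncomputable def ramp (δ a t : ℝ) : ℝ := min (max ((t - a) / (2 * δ)) 0) 1

/-- The tent map of `[0, 1]`. -/
noncomputable def tent (t : ℝ) : ℝ := 2 * min t (1 - t)

lemma ramp_nonneg (δ a t : ℝ) : 0 ≤ ramp δ a t := le_min (le_max_right _ _) zero_le_one

lemma ramp_le_one (δ a t : ℝ) : ramp δ a t ≤ 1 := min_le_right _ _

lemma tent_nonneg {t : ℝ} (h0 : 0 ≤ t) (h1 : t ≤ 1) : 0 ≤ tent t :=
  mul_nonneg zero_le_two (le_min h0 (by linarith))

lemma tent_le_one (t : ℝ) : tent t ≤ 1 := by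
  unfold tent
  have h1 := min_le_left t (1 - t)
  have h2 := min_le_right t (1 - t)
  linarith

/-- The slope `1 / (2 * δ)` is produced by `n` layers that double their input. -/
lemma scalarComputable_ramp (i : Fin d) {δ a R : ℝ} (hδ : 0 < δ) (hR : 1 ≤ R) (ha : |a| ≤ R) {n : ℕ}
    (hn : R / (2 * δ) ≤ 2 ^ n) : ScalarComputable d (n + 2) 2 (fun x => ramp δ a (x i)) := by
  have hR0 : 0 < R := by linarith
  have h1 : ∀ k : ℕ, LayerComputable d k 2 (fun x (_ : Fin 2) =>
      2 ^ k * max (x i / R - a / R) 0) := by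
    intro k
    induction k with
    | zero =>
      refine LayerComputable.of_input (fun _ => Pi.single i (1 / R)) (fun _ => a / R) (by simp)
        ?_ ?_ fun x => ?_
      · intro _ j
        by_cases hj : j = i
        · subst hj
          simp only [Pi.single_eq_same]
          rw [abs_of_pos (by positivity), div_le_one hR0]
          exact hR
        · simp [hj]
      · intro _
        rw [abs_div, abs_of_pos hR0, div_le_one hR0]
        exact ha
      · funext _
        simp only [layerMap, Pi.single_apply, ite_mul, zero_mul, Finset.sum_ite_eq',
          Finset.mem_univ, if_true, pow_zero, one_mul]
        congr 2; ring
    | succ k ih =>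
      refine ih.step (fun _ _ => 1) (fun _ => 0) (by simp) (by simp) (by simp) fun x => ?_
      funext _
      simp only [layerMap, Fin.sum_univ_two, one_mul, sub_zero]
      rw [max_eq_left (a := _ + _) (by positivity)]
      ring
  have hρ : R / (2 * δ) / 2 ^ n ≤ 1 := by
    rw [div_le_one (by positivity)]; exact hn
  have hρ0 : 0 ≤ R / (2 * δ) / 2 ^ n := by positivity
  refine ScalarComputable.min_one (h1 n) (by norm_num) ![R / (2 * δ) / 2 ^ n, 0] ?_ ?_ ?_
  · intro j
    fin_cases j
    · simpa [abs_of_nonneg hρ0] using hρ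
    · simp
  · intro x
    simp only [Fin.sum_univ_two, Matrix.cons_val_zero, Matrix.cons_val_one, zero_mul, add_zero]
    rw [ramp]
    congr 1
    rw [← mul_assoc, div_mul_cancel₀ _ (by positivity), mul_max_of_nonneg _ _ (by positivity)]
    congr 1
    · field_simp
    · simp
  · intro x
    simp only [Fin.sum_univ_two, Matrix.cons_val_zero, Matrix.cons_val_one, zero_mul, add_zero]
    positivity

lemma ScalarComputable.tent {g : (Fin d → ℝ) → ℝ} (h : ScalarComputable d L w g)
    (hg : ∀ x, g x ≤ 1) : ScalarComputable d (L + 2) (max w 6) (fun x => tent (g x)) := by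
  have h1 : LayerComputable d (L + 1) (max w 6) (fun x => ![g x, g x, max (g x - 1 / 2) 0,
      max (g x - 1 / 2) 0, max (g x - 1 / 2) 0, max (g x - 1 / 2) 0]) := by
    refine (LayerComputable.mono h (le_max_left w 6)).step (fun _ _ => 1)
      ![0, 0, 1 / 2, 1 / 2, 1 / 2, 1 / 2] (by simp) (by simp) ?_ fun x => ?_
    · intro k; fin_cases k <;> norm_num [abs_le]
    · funext k
      fin_cases k <;> simp [layerMap, h.nonneg x]
  refine h1.step (fun _ => ![1, 1, -1, -1, -1, -1]) (fun _ => 0) (by simp) ?_ (by simp) fun x => ?_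
  · intro _ i; fin_cases i <;> simp
  · funext _
    have h0 := h.nonneg x
    have h2 := hg x
    simp [layerMap, Fin.sum_univ_six, DeepReLU.tent]
    rcases le_total (g x) (1 / 2) with h3 | h3
    · rw [min_eq_left (by linarith), max_eq_right (a := g x - 2⁻¹) (by norm_num at h3 ⊢; linarith),
        max_eq_left (by linarith)]
      ring
    · rw [min_eq_right (by linarith), max_eq_left (a := g x - 2⁻¹) (by norm_num at h3 ⊢; linarith),
        max_eq_left (by linarith)]
      ring

/-- The product of the hat function with support `∏ i, [a i, a i + 2 * δ]` and the monomial
`∏ i ∈ l, (x i - a i) / (2 * δ)`, where `l` is a list of coordinates. -/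
noncomputable def localMonomial (δ : ℝ) (a : Fin d → ℝ) (l : List (Fin d)) (x : Fin d → ℝ) : ℝ :=
  (∏ i, tent (ramp δ (a i) (x i))) * (l.map fun i => ramp δ (a i) (x i)).prod

/-- Local monomials are approximated exponentially fast in the depth, with a width which does not
depend on the accuracy. -/
lemma exists_localMonomial {δ R : ℝ} (hδ : 0 < δ) (hR : 1 ≤ R) {a : Fin d → ℝ}
    (ha : ∀ i, |a i| ≤ R) {n : ℕ} (hn : R / (2 * δ) ≤ 2 ^ n) {k : ℕ} {l : List (Fin d)}
    (hl : l.length ≤ k) (m : ℕ) :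
    ∃ g, ScalarComputable d (n + 4 + (d + k) * (3 * m + 5)) (6 * (d + k) + 6) g ∧
      ∀ x, |g x - localMonomial δ a l x| ≤ (d + k) * (1 / 4 ^ m) := by
  set Y : List ((Fin d → ℝ) → ℝ) := List.ofFn (fun i x => tent (ramp δ (a i) (x i))) ++
    l.map (fun i x => ramp δ (a i) (x i)) with hY
  have hr : ∀ i, ScalarComputable d (n + 2) 2 (fun x => ramp δ (a i) (x i)) := fun i =>
    scalarComputable_ramp i hδ hR (ha i) hn
  have hlen : Y.length = d + l.length := by simp [hY]
  obtain ⟨g, hg, -, hge⟩ := exists_list_prod (L := n + 4) (w := 6) Y (by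
    intro y hy
    rw [hY, List.mem_append, List.mem_ofFn, List.mem_map] at hy
    rcases hy with ⟨i, rfl⟩ | ⟨i, -, rfl⟩
    · exact (hr i).tent fun x => ramp_le_one _ _ _
    · exact ((hr i).deepen (by omega)).mono (by norm_num)) (by
    intro y hy x
    rw [hY, List.mem_append, List.mem_ofFn, List.mem_map] at hy
    rcases hy with ⟨i, rfl⟩ | ⟨i, -, rfl⟩
    · exact tent_le_one _
    · exact ramp_le_one _ _ _) m
  have hle : Y.length ≤ d + k := by omega
  refine ⟨g, (hg.deepen ?_).mono ?_, fun x => ?_⟩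
  · gcongr
  · gcongr
  · have e : (Y.map fun y => y x).prod = localMonomial δ a l x := by
      rw [hY, List.map_append, List.prod_append, List.map_ofFn, List.prod_ofFn, List.map_map]
      rfl
    rw [← e]
    refine (hge x).trans ?_
    gcongr
    exact_mod_cast hle

/-! ### Taylor expansion of Hölder functions -/

lemma contDiff_partialDeriv {r k : ℕ} (i : Fin r) {g : (Fin r → ℝ) → ℝ}
    (hg : ContDiff ℝ ((k + 1 : ℕ) : WithTop ℕ∞) g) :
    ContDiff ℝ (k : WithTop ℕ∞) (partialDeriv i g) := by
  have h : ContDiff ℝ (k : WithTop ℕ∞) (fderiv ℝ g) := hg.fderiv_right (by norm_cast)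
  exact h.clm_apply contDiff_const

lemma contDiff_partialDeriv_iterate {r k : ℕ} (i : Fin r) (a : ℕ) {g : (Fin r → ℝ) → ℝ}
    (hg : ContDiff ℝ ((k + a : ℕ) : WithTop ℕ∞) g) :
    ContDiff ℝ (k : WithTop ℕ∞) ((partialDeriv i)^[a] g) := by
  induction a generalizing g with
  | zero => exact hg
  | succ a ih => exact ih (contDiff_partialDeriv i hg)

lemma hasDerivAt_add_single {r : ℕ} (i : Fin r) {g : (Fin r → ℝ) → ℝ} (hg : Differentiable ℝ g)
    (x : Fin r → ℝ) (t : ℝ) :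
    HasDerivAt (fun t => g (x + Pi.single i t)) (partialDeriv i g (x + Pi.single i t)) t := by
  have h1 : HasDerivAt (fun t : ℝ => x + Pi.single i t) (Pi.single i 1) t := by
    have h : HasDerivAt (fun t : ℝ => x + t • (Pi.single i 1 : Fin r → ℝ))
        ((1 : ℝ) • (Pi.single i 1 : Fin r → ℝ)) t :=
      ((hasDerivAt_id t).smul_const _).const_add x
    simpa only [← Pi.single_smul, smul_eq_mul, mul_one, one_smul] using h
  exact (hg (x + Pi.single i t)).hasFDerivAt.comp_hasDerivAt t h1

/-- Taylor's formula in one coordinate, under a Hölder condition on the derivative of top order. -/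
lemma abs_sub_taylor_coordinate_le {r : ℕ} (i : Fin r) {A θ : ℝ} (hA : 0 ≤ A) (hθ : 0 ≤ θ) (k : ℕ)
    {g : (Fin r → ℝ) → ℝ} (hg : ContDiff ℝ (k : WithTop ℕ∞) g)
    (hH : ∀ x y, |(partialDeriv i)^[k] g x - (partialDeriv i)^[k] g y| ≤ A * ‖x - y‖ ^ θ)
    (x : Fin r → ℝ) (h : ℝ) :
    |g (x + Pi.single i h) -
      ∑ a ∈ Finset.range (k + 1), (partialDeriv i)^[a] g x * (h ^ a / a.factorial)| ≤
      A * (|h| ^ k * |h| ^ θ) := by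
  induction k generalizing g h with
  | zero =>
    have := hH (x + Pi.single i h) x
    have hs : ‖(Pi.single i h : Fin r → ℝ)‖ = |h| := by rw [Pi.norm_single, Real.norm_eq_abs]
    simpa [hs] using this
  | succ k ih =>
    have hd : Differentiable ℝ g := hg.differentiable (by norm_cast)
    have ih' := ih (contDiff_partialDeriv i hg) hH
    set φ : ℝ → ℝ := fun t => g (x + Pi.single i t) -
      ∑ a ∈ Finset.range (k + 1 + 1), (partialDeriv i)^[a] g x * (t ^ a / a.factorial) with hφ
    set φ' : ℝ → ℝ := fun t => partialDeriv i g (x + Pi.single i t) -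
      ∑ a ∈ Finset.range (k + 1), (partialDeriv i)^[a] (partialDeriv i g) x *
        (t ^ a / a.factorial) with hφ'
    have hder : ∀ t, HasDerivAt φ (φ' t) t := by
      intro t
      refine (hasDerivAt_add_single i hd x t).sub ?_
      simp only [Finset.sum_range_succ' _ (k + 1)]
      simp only [pow_zero]
      refine HasDerivAt.add_const ((partialDeriv i)^[0] g x * (1 / (Nat.factorial 0 : ℝ)))
        (HasDerivAt.fun_sum fun a _ => ?_)
      refine HasDerivAt.const_mul _ ?_
      have h1 := (hasDerivAt_pow (a + 1) t).div_const ((a + 1).factorial : ℝ)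
      convert h1 using 1
      rw [Nat.factorial_succ]
      push_cast
      have : (a.factorial : ℝ) ≠ 0 := by positivity
      field_simp
    have h0 : φ 0 = 0 := by
      simp [hφ, Finset.sum_range_succ' _ (k + 1)]
    have hb : ∀ t ∈ Set.uIcc 0 h, ‖φ' t‖ ≤ A * (|h| ^ k * |h| ^ θ) := by
      intro t ht
      have ht' : |t| ≤ |h| := by
        have := Set.abs_sub_left_of_mem_uIcc ht
        simpa using this
      refine (ih' t).trans ?_
      gcongr
    have hm := Convex.norm_image_sub_le_of_norm_hasDerivWithin_le
      (fun t _ => (hder t).hasDerivWithinAt) hb (convex_uIcc 0 h) Set.left_mem_uIcc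
      Set.right_mem_uIcc
    rw [h0, sub_zero, sub_zero] at hm
    refine hm.trans (le_of_eq ?_)
    rw [Real.norm_eq_abs]; ring

/-- The derivative `∂^α` in the coordinates of the list `l` only. -/
noncomputable def listDeriv {r : ℕ} (l : List (Fin r)) (α : Fin r → ℕ) (g : (Fin r → ℝ) → ℝ) :
    (Fin r → ℝ) → ℝ :=
  l.foldr (fun i g => (partialDeriv i)^[α i] g) g

lemma listDeriv_append_update {r : ℕ} {l : List (Fin r)} {i : Fin r} (hi : i ∉ l) (α : Fin r → ℕ)
    (a : ℕ) (g : (Fin r → ℝ) → ℝ) :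
    listDeriv (l ++ [i]) (Function.update α i a) g = listDeriv l α ((partialDeriv i)^[a] g) := by
  simp only [listDeriv, List.foldr_append, List.foldr_cons, List.foldr_nil, Function.update_self]
  refine List.foldr_ext _ _ _ fun j hj b => ?_
  rw [Function.update_of_ne]
  rintro rfl
  exact hi hj

lemma sum_map_append_update {r : ℕ} {l : List (Fin r)} {i : Fin r} (hi : i ∉ l) (α : Fin r → ℕ)
    (a : ℕ) : ((l ++ [i]).map (Function.update α i a)).sum = (l.map α).sum + a := by
  have h : l.map (Function.update α i a) = l.map α := List.map_congr_left fun j hj => by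
    rw [Function.update_of_ne]
    rintro rfl
    exact hi hj
  simp [h]

lemma listDeriv_zero {r : ℕ} (l : List (Fin r)) (g : (Fin r → ℝ) → ℝ) : listDeriv l 0 g = g := by
  induction l with
  | nil => rfl
  | cons i l ih => exact ih

/-- Taylor's formula, one coordinate after another. The order of the coordinates is the one of the
iterated derivatives in `listDeriv`, so that partial derivatives need not be interchanged. The
monomials are given by lists of coordinates, and they do not depend on the function. -/
lemma exists_taylor_list {r : ℕ} (l : List (Fin r)) (hl : l.Nodup) (k : ℕ) :
    ∃ (J : Type) (_ : Fintype J) (wd : J → List (Fin r)) (C : ℝ), (∀ j, (wd j).length ≤ k) ∧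
      (∀ j, ∀ i ∈ wd j, i ∈ l) ∧ 0 ≤ C ∧ ∀ (A θ : ℝ), 0 ≤ A → 0 ≤ θ → ∀ g : (Fin r → ℝ) → ℝ,
      ContDiff ℝ (k : WithTop ℕ∞) g →
      (∀ α : Fin r → ℕ, (l.map α).sum ≤ k → ∀ x, |listDeriv l α g x| ≤ A) →
      (∀ α : Fin r → ℕ, (l.map α).sum = k → ∀ x y,
        |listDeriv l α g x - listDeriv l α g y| ≤ A * ‖x - y‖ ^ θ) →
      ∀ z : Fin r → ℝ, ∃ c : J → ℝ, (∀ j, |c j| ≤ A) ∧ ∀ x, (∀ i, i ∉ l → x i = z i) →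
        |g x - ∑ j, c j * ((wd j).map fun i => x i - z i).prod| ≤
          C * A * (‖x - z‖ ^ k * ‖x - z‖ ^ θ) := by
  classical
  induction l using List.reverseRecOn generalizing k with
  | nil =>
    refine ⟨Unit, inferInstance, fun _ => [], 0, by simp, by simp, le_rfl, ?_⟩
    intro A θ hA hθ g hg hb hH z
    refine ⟨fun _ => g z, fun _ => hb 0 (by simp) z, fun x hx => ?_⟩
    have : x = z := funext fun i => hx i (by simp)
    simp [this]
  | append_singleton l i ih =>
    rw [List.nodup_append] at hl
    have hil : i ∉ l := fun h => hl.2.2 i h i (by simp) rfl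
    choose J instJ wd C hwd hwl hC hT using fun k => ih hl.1 k
    refine ⟨Σ a : Fin (k + 1), J (k - a), inferInstance,
      fun p => List.replicate p.1 i ++ wd _ p.2, 1 + ∑ a : Fin (k + 1), C (k - a), ?_, ?_, ?_, ?_⟩
    · rintro ⟨a, j⟩
      have := hwd _ j
      simp only [List.length_append, List.length_replicate]
      omega
    · rintro ⟨a, j⟩ i' hi'
      rw [List.mem_append, List.mem_replicate] at hi'
      rcases hi' with hi' | hi'
      · simp [hi'.2]
      · simp [hwl _ j i' hi']
    · have : 0 ≤ ∑ a : Fin (k + 1), C (k - a) := Finset.sum_nonneg fun a _ => hC _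
      linarith
    intro A θ hA hθ g hg hb hH z
    have hsub : ∀ a : Fin (k + 1), k - (a : ℕ) + a = k := fun a => by omega
    have key : ∀ a : Fin (k + 1), ∃ c : J (k - a) → ℝ, (∀ j, |c j| ≤ A) ∧
        ∀ x, (∀ i, i ∉ l → x i = z i) → |(partialDeriv i)^[a] g x -
          ∑ j, c j * ((wd _ j).map fun i => x i - z i).prod| ≤
          C (k - a) * A * (‖x - z‖ ^ (k - (a : ℕ)) * ‖x - z‖ ^ θ) := by
      intro a
      refine hT (k - a) A θ hA hθ _ (contDiff_partialDeriv_iterate i a ?_) ?_ ?_ z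
      · rw [hsub]; exact hg
      · intro α hα x
        rw [← listDeriv_append_update hil]
        exact hb _ (by rw [sum_map_append_update hil]; omega) x
      · intro α hα x y
        rw [← listDeriv_append_update hil]
        exact hH _ (by rw [sum_map_append_update hil]; omega) x y
    choose c hcA hc using key
    refine ⟨fun p => c p.1 p.2 / (p.1 : ℕ).factorial, ?_, ?_⟩
    · rintro ⟨a, j⟩
      rw [abs_div, Nat.abs_cast]
      refine (div_le_self (abs_nonneg _) ?_).trans (hcA a j)
      exact_mod_cast Nat.one_le_iff_ne_zero.2 (Nat.factorial_ne_zero _)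
    intro x hx
    set h := x i - z i with hh
    set x' := Function.update x i (z i) with hx'
    have hxx' : x = x' + Pi.single i h := by
      funext j
      by_cases hj : j = i
      · subst hj; simp [hx', hh]
      · simp [hx', hj]
    have hx'z : ∀ j, j ∉ l → x' j = z j := by
      intro j hj
      by_cases hji : j = i
      · subst hji; simp [hx']
      · simp only [hx', Function.update_of_ne hji]
        exact hx j (by simp [hj, hji])
    have hh_le : |h| ≤ ‖x - z‖ := norm_le_pi_norm (x - z) i
    have hx'_le : ‖x' - z‖ ≤ ‖x - z‖ := by
      rw [pi_norm_le_iff_of_nonneg (norm_nonneg _)]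
      intro j
      by_cases hji : j = i
      · subst hji; simp [hx']
      · simp only [hx', Pi.sub_apply, Function.update_of_ne hji]
        exact norm_le_pi_norm (x - z) j
    have hT1 := abs_sub_taylor_coordinate_le i hA hθ k hg (fun x y => by
      have := hH (Function.update 0 i k) (by rw [sum_map_append_update hil]; simp [Pi.zero_def]) x y
      rwa [listDeriv_append_update hil, listDeriv_zero] at this) x' h
    rw [← hxx', Finset.sum_range] at hT1
    set X := ‖x - z‖ with hX
    have hX0 : 0 ≤ X := norm_nonneg _
    have hterm : ∀ a : Fin (k + 1), |(partialDeriv i)^[a] g x' * (h ^ (a : ℕ) / (a : ℕ).factorial) -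
        ∑ j, c a j / (a : ℕ).factorial *
          ((List.replicate (a : ℕ) i ++ wd _ j).map fun i => x i - z i).prod| ≤
        C (k - a) * A * (X ^ k * X ^ θ) := by
      intro a
      have e : ∑ j, c a j / (a : ℕ).factorial *
          ((List.replicate (a : ℕ) i ++ wd _ j).map fun i => x i - z i).prod =
          (∑ j, c a j * ((wd _ j).map fun i => x' i - z i).prod) *
            (h ^ (a : ℕ) / (a : ℕ).factorial) := by
        rw [Finset.sum_mul]
        refine Finset.sum_congr rfl fun j _ => ?_
        have e1 : (wd _ j).map (fun i => x' i - z i) = (wd _ j).map (fun i => x i - z i) :=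
          List.map_congr_left fun i' hi' => by
            have hne : i' ≠ i := by
              rintro rfl
              exact hil (hwl _ j _ hi')
            simp [hx', Function.update_of_ne hne]
        rw [e1, List.map_append, List.prod_append, List.map_replicate, List.prod_replicate, ← hh]
        ring
      rw [e, ← sub_mul, abs_mul, abs_div, abs_pow, Nat.abs_cast]
      have h1 := hc a x' hx'z
      have h2 : |h| ^ (a : ℕ) / ((a : ℕ).factorial : ℝ) ≤ X ^ (a : ℕ) := by
        refine (div_le_self (by positivity) ?_).trans (by gcongr)
        exact_mod_cast Nat.one_le_iff_ne_zero.2 (Nat.factorial_ne_zero _)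
      have h3 : ‖x' - z‖ ^ (k - (a : ℕ)) * ‖x' - z‖ ^ θ ≤ X ^ (k - (a : ℕ)) * X ^ θ := by gcongr
      have hC' := hC (k - a)
      calc _ ≤ C (k - a) * A * (X ^ (k - (a : ℕ)) * X ^ θ) * X ^ (a : ℕ) := by
            refine mul_le_mul (h1.trans ?_) h2 (by positivity) (by positivity)
            gcongr
        _ = C (k - a) * A * (X ^ (k - (a : ℕ) + a) * X ^ θ) := by rw [pow_add]; ring
        _ = _ := by rw [hsub]
    rw [Fintype.sum_sigma]
    have hsum := (Finset.abs_sum_le_sum_abs _ _).trans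
      (Finset.sum_le_sum fun a (_ : a ∈ (Finset.univ : Finset (Fin (k + 1)))) => hterm a)
    rw [Finset.sum_sub_distrib, ← Finset.sum_mul, ← Finset.sum_mul] at hsum
    have hT2 : A * (|h| ^ k * |h| ^ θ) ≤ A * (X ^ k * X ^ θ) := by gcongr
    refine (abs_sub_le _ _ _).trans ((add_le_add (hT1.trans hT2) hsum).trans (le_of_eq ?_))
    ring

/-- Functions in a Hölder ball are approximated by polynomials, with a fixed set of monomials and
bounded coefficients, uniformly in the centre. -/
lemma exists_taylor_holderBall (d : ℕ) {β : ℝ} (hβ : 0 < β) (K : ℝ) :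
    ∃ (J : Type) (_ : Fintype J) (wd : J → List (Fin d)) (k : ℕ) (C A : ℝ),
      (∀ j, (wd j).length ≤ k) ∧ 0 ≤ C ∧ 0 ≤ A ∧
      ∀ f ∈ holderBall d β K, ∀ z : Fin d → ℝ, ∃ c : J → ℝ, (∀ j, |c j| ≤ A) ∧
        ∀ x, |f x - ∑ j, c j * ((wd j).map fun i => x i - z i).prod| ≤ C * ‖x - z‖ ^ β := by
  obtain ⟨J, _, wd, C, hwd, -, hC, hT⟩ :=
    exists_taylor_list (List.finRange d) (List.nodup_finRange d) (strictFloor β)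
  have hceil : ⌈β⌉₊ = strictFloor β + 1 := by
    have := Nat.ceil_pos.2 hβ
    unfold strictFloor; omega
  have hθ : 0 < β - (strictFloor β : ℝ) := by
    have : strictFloor β < ⌈β⌉₊ := by omega
    linarith [Nat.lt_ceil.1 this]
  refine ⟨J, inferInstance, wd, strictFloor β, C * max K 0, max K 0, hwd, by positivity,
    by positivity, ?_⟩
  rintro f ⟨hf, hfn⟩ z
  have hsum : ∀ α : Fin d → ℕ, ((List.finRange d).map α).sum = ∑ i, α i := fun α => by
    rw [← List.ofFn_eq_map, List.sum_ofFn]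
  have hmem : ∀ (α : Fin d → ℕ) (k : ℕ), ∑ i, α i = k →
      α ∈ Finset.piAntidiag (Finset.univ : Finset (Fin d)) k := fun α k h =>
    Finset.mem_piAntidiag.2 ⟨h, fun _ _ => Finset.mem_univ _⟩
  have hreal : ∀ t : ℝ, ENNReal.ofReal t ≤ ENNReal.ofReal K → t ≤ max K 0 := by
    intro t ht
    rcases le_total t 0 with h | h
    · exact h.trans (le_max_right _ _)
    · rcases le_total K 0 with hK | hK
      · rw [ENNReal.ofReal_of_nonpos hK, nonpos_iff_eq_zero, ENNReal.ofReal_eq_zero] at ht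
        exact ht.trans (le_max_right _ _)
      · exact ((ENNReal.ofReal_le_ofReal_iff hK).1 ht).trans (le_max_left _ _)
  obtain ⟨c, hc, hcx⟩ := hT (max K 0) (β - strictFloor β) (by positivity) hθ.le f hf (by
    intro α hα x
    rw [hsum] at hα
    refine hreal _ (le_trans ?_ hfn)
    refine le_trans ?_ le_self_add
    refine le_trans ?_ (Finset.single_le_sum (fun _ _ => zero_le) (Finset.mem_range.2
      (by omega : ∑ i, α i < ⌈β⌉₊)))
    refine le_trans ?_ (Finset.single_le_sum (fun _ _ => zero_le) (hmem α _ rfl))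
    exact le_iSup (fun x => ENNReal.ofReal |multiDeriv α f x|) x) (by
    intro α hα x y
    rw [hsum] at hα
    by_cases hxy : x = y
    · subst hxy
      simp only [sub_self, abs_zero]
      positivity
    have hn : 0 < ‖x - y‖ := norm_pos_iff.2 (sub_ne_zero.2 hxy)
    rw [← div_le_iff₀ (Real.rpow_pos_of_pos hn _)]
    refine hreal _ (le_trans ?_ hfn)
    refine le_trans ?_ le_add_self
    refine le_trans ?_ (Finset.single_le_sum (fun _ _ => zero_le) (hmem α _ hα))
    exact le_iSup_of_le x (le_iSup_of_le y (le_iSup_of_le hxy le_rfl))) z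
  refine ⟨c, hc, fun x => (hcx x (by simp)).trans (le_of_eq ?_)⟩
  congr 1
  rw [← Real.rpow_natCast, ← Real.rpow_add_of_nonneg (norm_nonneg _) (by positivity) hθ.le]
  congr 1
  ring

/-! ### Lattice points close to a manifold -/

/-- For `β = 1` the approximating polynomials are constant, so the Hölder condition is a Lipschitz
condition. -/
lemma PolyHolder.exists_lipschitz {r q : ℕ} {D : Set (Fin r → ℝ)}
    {f : (Fin r → ℝ) → (Fin q → ℝ)} (hf : PolyHolder 1 D f) :
    ∃ K : ℝ, 0 < K ∧ ∀ x ∈ D, ∀ y ∈ D, ‖f x - f y‖ ≤ K * ‖x - y‖ := by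
  obtain ⟨K, hK, hf⟩ := hf
  refine ⟨K, hK, fun x hx y hy => ?_⟩
  rw [pi_norm_le_iff_of_nonneg (by positivity)]
  intro i
  obtain ⟨P, hP, hPx, -⟩ := hf i y hy
  have hP0 : P.totalDegree = 0 := by
    have : P.totalDegree < 1 := by exact_mod_cast hP
    omega
  rw [MvPolynomial.totalDegree_eq_zero_iff_eq_C] at hP0
  rw [hP0] at hPx
  simp only [MvPolynomial.eval_C, Real.rpow_one] at hPx
  have hy0 := hPx y hy
  rw [sub_self, norm_zero, mul_zero, abs_nonpos_iff, sub_eq_zero] at hy0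
  have := hPx x hx
  rwa [← hy0] at this

lemma card_piFinset_Icc_int {n N : ℕ} (c : Fin n → ℤ) :
    (Fintype.piFinset fun i => Finset.Icc (c i - N) (c i + N)).card = (2 * N + 1) ^ n := by
  rw [Fintype.card_piFinset, Finset.prod_congr rfl (g := fun _ => 2 * N + 1), Finset.prod_const,
    Finset.card_univ, Fintype.card_fin]
  intro i _
  rw [Int.card_Icc]
  omega

/-- A Lipschitz image of a bounded subset of `ℝ^n` has covering numbers of order `δ ^ (-n)`. -/
lemma exists_finset_cover_image {n d : ℕ} {T : Set (Fin n → ℝ)} (hT : Bornology.IsBounded T)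
    {g : (Fin n → ℝ) → (Fin d → ℝ)} {K : ℝ} (hK : 0 ≤ K)
    (hg : ∀ x ∈ T, ∀ y ∈ T, ‖g x - g y‖ ≤ K * ‖x - y‖) :
    ∃ C : ℝ, 0 ≤ C ∧ ∀ δ : ℝ, 0 < δ → δ ≤ 1 → ∃ A : Finset (Fin d → ℝ),
      (A.card : ℝ) ≤ C * δ ^ (-(n : ℝ)) ∧ ∀ y ∈ T, ∃ a ∈ A, ‖g y - a‖ ≤ K * δ := by
  classical
  obtain ⟨R, hR0, hR⟩ := hT.exists_pos_norm_le
  refine ⟨(2 * R + 5) ^ n, by positivity, fun δ hδ hδ1 => ?_⟩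
  set N : ℕ := ⌈R / δ⌉₊ + 1 with hN
  set cell : (Fin n → ℝ) → (Fin n → ℤ) := fun y i => ⌊y i / δ⌋ with hcell
  have hrep : ∀ q : Fin n → ℤ, ∃ a : Fin d → ℝ, ∀ y ∈ T, cell y = q → ‖g y - a‖ ≤ K * δ := by
    intro q
    by_cases hq : ∃ y ∈ T, cell y = q
    · obtain ⟨y₀, hy₀, hq⟩ := hq
      refine ⟨g y₀, fun y hy hyq => (hg y hy y₀ hy₀).trans ?_⟩
      refine mul_le_mul_of_nonneg_left ?_ hK
      rw [pi_norm_le_iff_of_nonneg hδ.le]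
      intro i
      have h1 : ⌊y i / δ⌋ = ⌊y₀ i / δ⌋ := congrFun (hyq.trans hq.symm) i
      have h2 := Int.abs_sub_lt_one_of_floor_eq_floor h1
      rw [← sub_div, abs_div, abs_of_pos hδ, div_lt_one hδ] at h2
      exact h2.le
    · exact ⟨0, fun y hy hyq => (hq ⟨y, hy, hyq⟩).elim⟩
  choose rep hrep using hrep
  refine ⟨(Fintype.piFinset fun _ => Finset.Icc ((0 : ℤ) - N) (0 + N)).image rep, ?_, ?_⟩
  · have h1 : (((Fintype.piFinset fun _ : Fin n => Finset.Icc ((0 : ℤ) - N) (0 + N)).image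
        rep).card : ℝ) ≤ ((2 * N + 1) ^ n : ℕ) := by
      rw [← card_piFinset_Icc_int (fun _ : Fin n => (0 : ℤ))]
      exact_mod_cast Finset.card_image_le
    refine h1.trans ?_
    push_cast
    rw [Real.rpow_neg hδ.le, Real.rpow_natCast, ← inv_pow, ← mul_pow]
    gcongr
    have h2 : (N : ℝ) ≤ R / δ + 2 := by
      rw [hN]; push_cast
      linarith [Nat.ceil_lt_add_one (by positivity : 0 ≤ R / δ)]
    have h3 : 1 ≤ δ⁻¹ := (one_le_inv₀ hδ).2 hδ1
    rw [div_eq_mul_inv] at h2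
    linarith
  · intro y hy
    refine ⟨rep (cell y), Finset.mem_image_of_mem _ ?_, hrep _ y hy rfl⟩
    rw [Fintype.mem_piFinset]
    intro i
    have h1 : |y i| ≤ R := (norm_le_pi_norm y i).trans (hR y hy)
    have h2 : |y i / δ| ≤ R / δ := by
      rw [abs_div, abs_of_pos hδ]; gcongr
    have h3 := Nat.le_ceil (R / δ)
    rw [abs_le] at h2
    have h4 := Int.floor_le (y i / δ)
    have h5 := Int.lt_floor_add_one (y i / δ)
    rw [Finset.mem_Icc]
    constructor
    · have : -((N : ℤ) : ℝ) ≤ (⌊y i / δ⌋ : ℝ) := by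
        rw [hN]; push_cast; linarith
      rw [zero_sub]; exact_mod_cast this
    · have : (⌊y i / δ⌋ : ℝ) ≤ ((N : ℤ) : ℝ) := by
        rw [hN]; push_cast; linarith
      rw [zero_add]; exact_mod_cast this

/-- The covering numbers of an `n`-dimensional manifold are of order `δ ^ (-n)`. -/
lemma IsCompactManifoldWithSmoothCoords.exists_finset_cover {d n : ℕ} {M : Set (Fin d → ℝ)}
    (hM : IsCompactManifoldWithSmoothCoords n M) :
    ∃ C K : ℝ, 0 ≤ C ∧ 0 ≤ K ∧ ∀ δ : ℝ, 0 < δ → δ ≤ 1 → ∃ A : Finset (Fin d → ℝ),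
      (A.card : ℝ) ≤ C * δ ^ (-(n : ℝ)) ∧ ∀ x ∈ M, ∃ a ∈ A, ‖x - a‖ ≤ K * δ := by
  classical
  obtain ⟨hMc, r, ψ, hψ, hcov, hH⟩ := hM
  have key : ∀ j, ∃ C K : ℝ, 0 ≤ C ∧ 0 ≤ K ∧ ∀ δ : ℝ, 0 < δ → δ ≤ 1 →
      ∃ A : Finset (Fin d → ℝ), (A.card : ℝ) ≤ C * δ ^ (-(n : ℝ)) ∧
        ∀ x ∈ (ψ j).source, ∃ a ∈ A, ‖x - a‖ ≤ K * δ := by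
    intro j
    obtain ⟨h1, h2⟩ := hH 1 one_pos j
    obtain ⟨K₁, hK₁, h1⟩ := h1.exists_lipschitz
    obtain ⟨K₂, hK₂, h2⟩ := h2.exists_lipschitz
    have hS : Bornology.IsBounded (ψ j).source :=
      hMc.isBounded.subset (by rw [← hcov]; exact Set.subset_iUnion (fun j => (ψ j).source) j)
    have hT : Bornology.IsBounded (ψ j).target := by
      obtain ⟨D, hD⟩ := (Metric.isBounded_iff.1 hS)
      refine Metric.isBounded_iff.2 ⟨K₁ * D, fun y hy y' hy' => ?_⟩
      have := h1 _ ((ψ j).map_target hy) _ ((ψ j).map_target hy')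
      rw [(ψ j).right_inv hy, (ψ j).right_inv hy'] at this
      rw [dist_eq_norm]
      refine this.trans (mul_le_mul_of_nonneg_left ?_ hK₁.le)
      rw [← dist_eq_norm]
      exact hD ((ψ j).map_target hy) ((ψ j).map_target hy')
    obtain ⟨C, hC, hA⟩ := exists_finset_cover_image hT hK₂.le h2
    refine ⟨C, K₂, hC, hK₂.le, fun δ hδ hδ1 => ?_⟩
    obtain ⟨A, hAc, hA⟩ := hA δ hδ hδ1
    refine ⟨A, hAc, fun x hx => ?_⟩
    obtain ⟨a, ha, h⟩ := hA _ ((ψ j).map_source hx)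
    rw [(ψ j).left_inv hx] at h
    exact ⟨a, ha, h⟩
  choose C K hC hK key using key
  refine ⟨∑ j, C j, ∑ j, K j, Finset.sum_nonneg fun j _ => hC j,
    Finset.sum_nonneg fun j _ => hK j, fun δ hδ hδ1 => ?_⟩
  choose A hAc hA using fun j => key j δ hδ hδ1
  refine ⟨Finset.univ.biUnion A, ?_, fun x hx => ?_⟩
  · rw [Finset.sum_mul]
    refine le_trans ?_ (Finset.sum_le_sum fun j _ => hAc j)
    exact_mod_cast Finset.card_biUnion_le
  · rw [← hcov, Set.mem_iUnion] at hx
    obtain ⟨j, hj⟩ := hx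
    obtain ⟨a, ha, h⟩ := hA j x hj
    refine ⟨a, Finset.mem_biUnion.2 ⟨j, Finset.mem_univ _, ha⟩, h.trans ?_⟩
    gcongr
    exact Finset.single_le_sum (fun j _ => hK j) (Finset.mem_univ j)

/-- The number of points of the lattice `δ ℤ^d` at distance less than `δ` from an `n`-dimensional
manifold is of order `δ ^ (-n)`, whatever the ambient dimension `d` is. -/
lemma IsCompactManifoldWithSmoothCoords.exists_lattice {d n : ℕ} {M : Set (Fin d → ℝ)}
    (hM : IsCompactManifoldWithSmoothCoords n M) :
    ∃ C : ℝ, 0 ≤ C ∧ ∀ δ : ℝ, 0 < δ → δ ≤ 1 → ∃ Z : Finset (Fin d → ℤ),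
      (Z.card : ℝ) ≤ C * δ ^ (-(n : ℝ)) ∧
      ∀ z, z ∈ Z ↔ ∃ x ∈ M, ∀ i, |x i / δ - z i| < 1 := by
  classical
  obtain ⟨C, K, hC, hK, h⟩ := hM.exists_finset_cover
  set N : ℕ := ⌈K⌉₊ + 2 with hN
  refine ⟨C * (2 * N + 1) ^ d, by positivity, fun δ hδ hδ1 => ?_⟩
  obtain ⟨A, hAc, hA⟩ := h δ hδ hδ1
  set B : Finset (Fin d → ℤ) := A.biUnion fun a =>
    Fintype.piFinset fun i => Finset.Icc (⌊a i / δ⌋ - N) (⌊a i / δ⌋ + N) with hB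
  refine ⟨B.filter fun z => ∃ x ∈ M, ∀ i, |x i / δ - z i| < 1, ?_, fun z => ?_⟩
  · have h1 : B.card ≤ A.card * (2 * N + 1) ^ d :=
      Finset.card_biUnion_le_card_mul _ _ _ fun a _ => (card_piFinset_Icc_int _).le
    calc _ ≤ (B.card : ℝ) := by exact_mod_cast Finset.card_filter_le _ _
      _ ≤ A.card * (2 * N + 1) ^ d := by exact_mod_cast h1
      _ ≤ (C * δ ^ (-(n : ℝ))) * (2 * N + 1) ^ d := by gcongr
      _ = _ := by ring
  · rw [Finset.mem_filter, and_iff_right_iff_imp]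
    rintro ⟨x, hx, hz⟩
    obtain ⟨a, ha, hxa⟩ := hA x hx
    refine Finset.mem_biUnion.2 ⟨a, ha, Fintype.mem_piFinset.2 fun i => ?_⟩
    have h1 : |x i - a i| ≤ K * δ := (norm_le_pi_norm (x - a) i).trans hxa
    have h2 : |x i / δ - a i / δ| ≤ K := by
      rw [← sub_div, abs_div, abs_of_pos hδ, div_le_iff₀ hδ]; exact h1
    have h3 := hz i
    have h4 := Int.floor_le (a i / δ)
    have h5 := Int.lt_floor_add_one (a i / δ)
    have h6 := Nat.le_ceil K
    rw [abs_le] at h2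
    rw [abs_lt] at h3
    rw [Finset.mem_Icc]
    constructor
    · have : (⌊a i / δ⌋ : ℝ) - ((N : ℤ) : ℝ) ≤ z i := by
        rw [hN]; push_cast; linarith
      exact_mod_cast this
    · have : (z i : ℝ) ≤ (⌊a i / δ⌋ : ℝ) + ((N : ℤ) : ℝ) := by
        rw [hN]; push_cast; linarith
      exact_mod_cast this

/-! ### The partition of unity by hat functions -/

/-- The tent map of the ramp on `[δ (z - 1), δ (z + 1)]` is the hat function centred at `δ z`. -/
lemma tent_ramp {δ : ℝ} (hδ : 0 < δ) (z t : ℝ) :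
    tent (ramp δ (δ * (z - 1)) t) = max (1 - |t / δ - z|) 0 := by
  have e : (t - δ * (z - 1)) / (2 * δ) = (t / δ - z + 1) / 2 := by field_simp; ring
  rw [ramp, e, tent]
  set u := t / δ - z
  rcases abs_cases u with ⟨h, h'⟩ | ⟨h, h'⟩ <;> rw [h]
  · rw [max_eq_left (by linarith : 0 ≤ (u + 1) / 2)]
    rcases le_total u 1 with h1 | h1
    · rw [min_eq_left (a := (u + 1) / 2) (by linarith), min_eq_right (by linarith),
        max_eq_left (by linarith)]
      ring
    · rw [min_eq_right (a := (u + 1) / 2) (by linarith), min_eq_right (by linarith),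
        max_eq_right (by linarith)]
      ring
  · rcases le_total (-1) u with h1 | h1
    · rw [max_eq_left (by linarith : 0 ≤ (u + 1) / 2), min_eq_left (a := (u + 1) / 2) (by linarith),
        min_eq_left (by linarith), max_eq_left (by linarith)]
      ring
    · rw [max_eq_right (by linarith : (u + 1) / 2 ≤ 0), min_eq_left (zero_le_one' ℝ),
        min_eq_left (by linarith), max_eq_right (by linarith)]
      ring

lemma sum_hat_eq_one (s : ℝ) :
    ∑ z ∈ ({⌊s⌋, ⌊s⌋ + 1} : Finset ℤ), max (1 - |s - (z : ℝ)|) 0 = 1 := by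
  have h1 := Int.floor_le s
  have h2 := Int.lt_floor_add_one s
  rw [Finset.sum_pair (by omega)]
  push_cast
  rw [abs_of_nonneg (by linarith), abs_of_nonpos (by linarith), max_eq_left (by linarith),
    max_eq_left (by linarith)]
  ring

lemma eq_floor_or_of_abs_sub_lt {s : ℝ} {z : ℤ} (h : |s - z| < 1) : z = ⌊s⌋ ∨ z = ⌊s⌋ + 1 := by
  rw [abs_lt] at h
  have h1 := Int.floor_le s
  have h2 := Int.lt_floor_add_one s
  have h3 : (⌊s⌋ : ℝ) < z + 1 := by linarith
  have h4 : (z : ℝ) < ⌊s⌋ + 2 := by linarith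
  have h3' : ⌊s⌋ < z + 1 := by exact_mod_cast h3
  have h4' : z < ⌊s⌋ + 2 := by exact_mod_cast h4
  omega

/-- In units of the mesh: the hat functions centred at `Z` add up to `1` at every point all of whose neighbours in the
lattice belong to `Z`. -/
lemma sum_prod_hat_eq_one {d : ℕ} (s : Fin d → ℝ) (Z : Finset (Fin d → ℤ))
    (hZ : ∀ z : Fin d → ℤ, (∀ i, |s i - z i| < 1) → z ∈ Z) :
    ∑ z ∈ Z, ∏ i, max (1 - |s i - (z i : ℝ)|) 0 = 1 := by
  classical
  set P := Fintype.piFinset fun i => ({⌊s i⌋, ⌊s i⌋ + 1} : Finset ℤ) with hP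
  have hne : ∀ z : Fin d → ℤ, ∏ i, max (1 - |s i - (z i : ℝ)|) 0 ≠ 0 → ∀ i, |s i - z i| < 1 := by
    intro z hz i
    by_contra hi
    exact hz (Finset.prod_eq_zero (Finset.mem_univ i) (max_eq_right (by linarith)))
  have h1 : ∑ z ∈ Z, ∏ i, max (1 - |s i - (z i : ℝ)|) 0 =
      ∑ z ∈ Z ∪ P, ∏ i, max (1 - |s i - (z i : ℝ)|) 0 :=
    Finset.sum_subset Finset.subset_union_left fun z _ hz => by
      by_contra h; exact hz (hZ z (hne z h))
  have h2 : ∑ z ∈ P, ∏ i, max (1 - |s i - (z i : ℝ)|) 0 =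
      ∑ z ∈ Z ∪ P, ∏ i, max (1 - |s i - (z i : ℝ)|) 0 :=
    Finset.sum_subset Finset.subset_union_right fun z _ hz => by
      by_contra h
      refine hz (Fintype.mem_piFinset.2 fun i => ?_)
      simpa using eq_floor_or_of_abs_sub_lt (hne z h i)
  rw [h1, ← h2, hP, ← Finset.prod_univ_sum (fun i => ({⌊s i⌋, ⌊s i⌋ + 1} : Finset ℤ))
    (fun i z => max (1 - |s i - (z : ℝ)|) 0)]
  exact Finset.prod_eq_one fun i _ => sum_hat_eq_one (s i)

/-! ### Approximation by local monomials -/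

/-- The point `δ (z - 1)`, the lower corner of the support of the hat function
centred at `δ z`. With this corner as the Taylor centre all increments are non-negative. -/
noncomputable def corner {d : ℕ} (δ : ℝ) (z : Fin d → ℤ) : Fin d → ℝ := fun i => δ * (z i - 1)

/-- Averaging Taylor polynomials with the partition of unity. -/
lemma abs_sub_sum_localMonomial_le {d : ℕ} {J : Type} [Fintype J] {wd : J → List (Fin d)}
    {β C δ : ℝ} (hβ : 0 < β) (hC : 0 ≤ C) (hδ : 0 < δ) {f : (Fin d → ℝ) → ℝ}
    {c : (Fin d → ℤ) → J → ℝ}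
    (hc : ∀ z x, |f x - ∑ j, c z j * ((wd j).map fun i => x i - corner δ z i).prod| ≤
      C * ‖x - corner δ z‖ ^ β)
    {Z : Finset (Fin d → ℤ)} {x : Fin d → ℝ}
    (hZ : ∀ z : Fin d → ℤ, (∀ i, |x i / δ - z i| < 1) → z ∈ Z) :
    |f x - ∑ z ∈ Z, ∑ j, c z j * (2 * δ) ^ (wd j).length *
      localMonomial δ (corner δ z) (wd j) x| ≤ C * (2 * δ) ^ β := by
  set φ : (Fin d → ℤ) → ℝ := fun z => ∏ i, tent (ramp δ (corner δ z i) (x i)) with hφ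
  have hφ0 : ∀ z, 0 ≤ φ z := fun z => Finset.prod_nonneg fun i _ =>
    tent_nonneg (ramp_nonneg _ _ _) (ramp_le_one _ _ _)
  have hφhat : ∀ z, φ z = ∏ i, max (1 - |x i / δ - (z i : ℝ)|) 0 := fun z =>
    Finset.prod_congr rfl fun i _ => tent_ramp hδ _ _
  have hsum : ∑ z ∈ Z, φ z = 1 := by
    simp only [hφhat]
    exact sum_prod_hat_eq_one (fun i => x i / δ) Z hZ
  set Q : (Fin d → ℤ) → ℝ := fun z =>
    ∑ j, c z j * (2 * δ) ^ (wd j).length * ((wd j).map fun i => ramp δ (corner δ z i) (x i)).prod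
    with hQ
  have hE : ∀ z, ∑ j, c z j * (2 * δ) ^ (wd j).length * localMonomial δ (corner δ z) (wd j) x =
      φ z * Q z := fun z => by
    rw [hQ, Finset.mul_sum]
    refine Finset.sum_congr rfl fun j _ => ?_
    rw [localMonomial]; ring
  have hf : f x = ∑ z ∈ Z, φ z * f x := by rw [← Finset.sum_mul, hsum, one_mul]
  have hloc : ∀ z ∈ Z, |φ z * f x - φ z * Q z| ≤ φ z * (C * (2 * δ) ^ β) := by
    intro z _
    rw [← mul_sub, abs_mul, abs_of_nonneg (hφ0 z)]
    by_cases h0 : φ z = 0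
    · simp [h0]
    refine mul_le_mul_of_nonneg_left ?_ (hφ0 z)
    have hlt : ∀ i, |x i / δ - z i| < 1 := by
      intro i
      by_contra hi
      exact h0 ((hφhat z).trans
        (Finset.prod_eq_zero (Finset.mem_univ i) (max_eq_right (by linarith))))
    have hdiv : ∀ i, (x i - corner δ z i) / (2 * δ) = (x i / δ - z i + 1) / 2 := by
      intro i; rw [corner]; field_simp; ring
    have h01 : ∀ i, 0 ≤ (x i - corner δ z i) / (2 * δ) ∧ (x i - corner δ z i) / (2 * δ) ≤ 1 := by
      intro i
      have := abs_lt.1 (hlt i)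
      rw [hdiv]
      constructor <;> linarith
    have hramp : ∀ i, 2 * δ * ramp δ (corner δ z i) (x i) = x i - corner δ z i := by
      intro i
      rw [ramp, max_eq_left (h01 i).1, min_eq_left (h01 i).2]
      field_simp
    have hQz : Q z = ∑ j, c z j * ((wd j).map fun i => x i - corner δ z i).prod := by
      refine Finset.sum_congr rfl fun j _ => ?_
      simp only [← hramp]
      rw [List.prod_map_mul, List.map_const', List.prod_replicate]
      ring
    rw [hQz]
    refine (hc z x).trans ?_
    have hn : ‖x - corner δ z‖ ≤ 2 * δ := by
      rw [pi_norm_le_iff_of_nonneg (by positivity)]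
      intro i
      have h1 := (h01 i).1
      have h2 := (h01 i).2
      rw [div_le_one (by positivity)] at h2
      have h3 : 0 ≤ x i - corner δ z i := by
        rw [← hramp]
        exact mul_nonneg (by positivity) (ramp_nonneg _ _ _)
      rw [Pi.sub_apply, Real.norm_eq_abs, abs_of_nonneg h3]
      exact h2
    gcongr
  simp only [hE]
  rw [hf, ← Finset.sum_sub_distrib]
  refine (Finset.abs_sum_le_sum_abs _ _).trans ((Finset.sum_le_sum hloc).trans ?_)
  rw [← Finset.sum_mul, hsum, one_mul]

lemma ScalarComputable.linearReadout {d L w : ℕ} {g : (Fin d → ℝ) → ℝ}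
    (h : ScalarComputable d L w g) {b : ℝ} (hb : |b| ≤ 1) :
    LinearReadout d L w ((L + 1) * (w * (w + d + 1)) + 1) (fun x => b * g x) := by
  obtain ⟨s, h⟩ := h
  exact ⟨Unit, inferInstance, _, _, fun _ => b, h.sparsity, fun _ => hb, by simp, by simp⟩

/-- Sums of local monomials with coefficients of absolute value at most `B` are approximated by
networks. Every summand is repeated `B` times with its coefficient divided by `B`, so that all
parameters are in `[-1, 1]`. -/
lemma exists_uniformClass_sum {d : ℕ} {J : Type} [Fintype J] {wd : J → List (Fin d)} {k B : ℕ}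
    (hB : 0 < B) (hk : ∀ j, (wd j).length ≤ k) {δ R : ℝ} (hδ : 0 < δ) (hR : 1 ≤ R)
    {Z : Finset (Fin d → ℤ)} {a : (Fin d → ℤ) → Fin d → ℝ} (ha : ∀ z ∈ Z, ∀ i, |a z i| ≤ R)
    {b : (Fin d → ℤ) → J → ℝ} (hb : ∀ z j, |b z j| ≤ B) {n m L p s w : ℕ}
    (hn : R / (2 * δ) ≤ 2 ^ n) (hw : w = 6 * (d + k) + 6)
    (hL : n + 5 + (d + k) * (3 * m + 5) ≤ L)
    (hp : Z.card * Fintype.card J * B * w ≤ p)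
    (hs : Z.card * Fintype.card J * B * (L * (w * (w + d + 1)) + 1) ≤ s) :
    ∃ g ∈ uniformClass L d p 1 s, ∀ x,
      |g x 0 - ∑ z ∈ Z, ∑ j, b z j * localMonomial δ (a z) (wd j) x| ≤
        Z.card * Fintype.card J * B * ((d + k) * (1 / 4 ^ m)) := by
  have hB0 : (0 : ℝ) < B := by exact_mod_cast hB
  obtain ⟨L, rfl⟩ : ∃ L', L = L' + 1 := ⟨L - 1, by omega⟩
  have h1 : ∀ z j, ∃ g : (Fin d → ℝ) → ℝ, z ∈ Z → ScalarComputable d L w g ∧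
      ∀ x, |g x - localMonomial δ (a z) (wd j) x| ≤ (d + k) * (1 / 4 ^ m) := by
    intro z j
    by_cases hz : z ∈ Z
    · obtain ⟨g, hg, hgx⟩ := exists_localMonomial hδ hR (ha z hz) hn (hk j) m
      rw [hw]
      exact ⟨g, fun _ => ⟨hg.deepen (by omega), hgx⟩⟩
    · exact ⟨0, fun h => (hz h).elim⟩
  choose g hg using h1
  have h2 := LinearReadout.sum (Z ×ˢ (Finset.univ : Finset (J × Fin B)))
    (h := fun t x => b t.1 t.2.1 / B * g t.1 t.2.1 x) fun t ht =>
      ((hg t.1 t.2.1 (Finset.mem_product.1 ht).1).1.linearReadout (b := b t.1 t.2.1 / B) (by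
        rw [abs_div, Nat.abs_cast, div_le_one hB0]; exact hb _ _))
  have hcard : (Z ×ˢ (Finset.univ : Finset (J × Fin B))).card = Z.card * Fintype.card J * B := by
    simp [Finset.card_product, mul_assoc]
  rw [hcard] at h2
  obtain ⟨G, hG, hGx⟩ := (h2.mono le_rfl hs).exists_uniformClass hp
  refine ⟨G, hG, fun x => ?_⟩
  have hsumB : ∀ F : (Fin d → ℤ) → J → ℝ,
      ∑ t ∈ Z ×ˢ (Finset.univ : Finset (J × Fin B)), b t.1 t.2.1 / B * F t.1 t.2.1 =
        ∑ z ∈ Z, ∑ j, b z j * F z j := by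
    intro F
    rw [Finset.sum_product]
    refine Finset.sum_congr rfl fun z _ => ?_
    rw [Fintype.sum_prod_type]
    refine Finset.sum_congr rfl fun j _ => ?_
    simp only [Finset.sum_const, Finset.card_univ, Fintype.card_fin, nsmul_eq_mul]
    field_simp
  rw [hGx, hsumB fun z j => g z j x, ← Finset.sum_sub_distrib]
  calc _ ≤ ∑ z ∈ Z, ∑ _j : J, (B : ℝ) * ((d + k) * (1 / 4 ^ m)) := by
        refine (Finset.abs_sum_le_sum_abs _ _).trans (Finset.sum_le_sum fun z hz => ?_)
        rw [← Finset.sum_sub_distrib]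
        refine (Finset.abs_sum_le_sum_abs _ _).trans (Finset.sum_le_sum fun j _ => ?_)
        rw [← mul_sub, abs_mul]
        exact mul_le_mul (hb z j) ((hg z j hz).2 x) (abs_nonneg _) hB0.le
    _ = _ := by
        simp only [Finset.sum_const, Finset.card_univ, nsmul_eq_mul]
        ring

/-- A power of `1 / η` is bounded by `2 ^ n` with `n` of order `log (1 / η)`. -/
lemma exists_le_two_pow (A e : ℝ) (he : 0 ≤ e) :
    ∃ c : ℝ, 0 ≤ c ∧ ∀ η : ℝ, 0 < η → η ≤ 1 / 2 →
      ∃ n : ℕ, A * η ^ (-e) ≤ 2 ^ n ∧ (n : ℝ) ≤ c * Real.log (1 / η) := by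
  have hl2 : 0 < Real.log 2 := Real.log_pos one_lt_two
  have hA1 : 1 ≤ max A 1 := le_max_right _ _
  have hlA : 0 ≤ Real.log (max A 1) := Real.log_nonneg hA1
  refine ⟨(Real.log (max A 1) / Real.log 2 + 1) / Real.log 2 + e / Real.log 2, by positivity,
    fun η hη hη2 => ?_⟩
  have hl : Real.log 2 ≤ Real.log (1 / η) := by
    refine Real.log_le_log two_pos ?_
    rw [le_div_iff₀ hη]; linarith
  have hy : 0 ≤ (Real.log (max A 1) + e * Real.log (1 / η)) / Real.log 2 := by
    have : 0 ≤ Real.log (1 / η) := hl2.le.trans hl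
    positivity
  refine ⟨⌈(Real.log (max A 1) + e * Real.log (1 / η)) / Real.log 2⌉₊, ?_, ?_⟩
  · have h1 := Nat.le_ceil ((Real.log (max A 1) + e * Real.log (1 / η)) / Real.log 2)
    rw [div_le_iff₀ hl2] at h1
    have h2 : A * η ^ (-e) ≤ max A 1 * η ^ (-e) :=
      mul_le_mul_of_nonneg_right (le_max_left _ _) (Real.rpow_nonneg hη.le _)
    refine h2.trans ?_
    rw [← Real.log_le_log_iff (by positivity) (by positivity), Real.log_mul (by positivity)
      (by positivity), Real.log_rpow hη, Real.log_pow]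
    rw [one_div, Real.log_inv] at h1 ⊢
    linarith
  · refine (Nat.ceil_lt_add_one hy).le.trans ?_
    have h3 : Real.log (max A 1) / Real.log 2 + 1 ≤
        (Real.log (max A 1) / Real.log 2 + 1) / Real.log 2 * Real.log (1 / η) := by
      rw [div_mul_eq_mul_div, le_div_iff₀ hl2]
      gcongr
    rw [add_div, add_mul, mul_div_right_comm]
    linarith

end DeepReLU

open DeepReLU in
theorem theorem2 (d dstar : ℕ) (M : Set (Fin d → ℝ))
    (hM : DeepReLU.IsCompactManifoldWithSmoothCoords dstar M)
    (β K : ℝ) (hβ : 0 < β) :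
    ∃ c C C' : ℝ, 0 < c ∧ 0 < C ∧ 0 < C' ∧
      ∀ η : ℝ, 0 < η → η ≤ 1 / 2 →
        ∀ L p s : ℕ,
          c * Real.log (1 / η) ≤ (L : ℝ) →
          C * η ^ (-((dstar : ℝ) / β)) < (p : ℝ) →
          C' * (L : ℝ) * η ^ (-((dstar : ℝ) / β)) ≤ (s : ℝ) →
          ∀ f : (Fin d → ℝ) → ℝ, (∀ x, f x ∈ Set.Icc (-1 : ℝ) 1) →
            f ∈ DeepReLU.holderBall d β K →
            ∃ g ∈ DeepReLU.uniformClass L d p 1 s, ∀ x ∈ M, |g x 0 - f x| ≤ η := by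
  obtain ⟨J, _, wd, k, Ct, A, hk, hCt, hA, hT⟩ := exists_taylor_holderBall d hβ K
  obtain ⟨Cl, hCl, hlat⟩ := hM.exists_lattice
  obtain ⟨R, hR0, hR⟩ := hM.1.isBounded.exists_pos_norm_le
  -- The mesh is `δ = κ * η ^ (1 / β)`, so that the Taylor error `Ct * (2 * δ) ^ β` is at most
  -- `η / 2`.
  set q : ℝ := 2 * (Ct * 2 ^ β) + 1 with hq
  have hq1 : 1 ≤ q := by
    have : 0 ≤ Ct * (2 : ℝ) ^ β := by positivity
    linarith
  have hq0 : 0 < q := by linarith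
  set κ : ℝ := q ^ (-(1 / β)) with hκ
  have hκ0 : 0 < κ := Real.rpow_pos_of_pos hq0 _
  have hκ1 : κ ≤ 1 := Real.rpow_le_one_of_one_le_of_nonpos hq1 (by
    rw [neg_nonpos]; positivity)
  set B : ℕ := ⌈A * 2 ^ k⌉₊ + 1 with hB
  have hAB : A * 2 ^ k ≤ B := by
    rw [hB]; push_cast; linarith [Nat.le_ceil (A * 2 ^ k)]
  set w : ℕ := 6 * (d + k) + 6 with hw
  -- The number of summands is at most `T * η ^ (-(dstar / β))`.
  set T : ℝ := Cl * κ ^ (-(dstar : ℝ)) * Fintype.card J * B with hTdef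
  have hT0 : 0 ≤ T := by positivity
  obtain ⟨c₁, hc₁, hn⟩ := exists_le_two_pow ((R + 2) / (2 * κ)) (1 / β) (by positivity)
  obtain ⟨c₂, hc₂, hm⟩ := exists_le_two_pow (2 * (T * (d + k))) (1 + dstar / β) (by positivity)
  have hl2 : 0 < Real.log 2 := Real.log_pos one_lt_two
  refine ⟨c₁ + (d + k) * (3 * c₂) + (5 + 5 * (d + k)) / Real.log 2, T * w + 1,
    T * (w * (w + d + 1) + 1) + 1, by positivity, by positivity, by positivity, ?_⟩
  intro η hη hη2 L p s hL hp hs f _ hf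
  obtain ⟨n, hn2, hnl⟩ := hn η hη hη2
  obtain ⟨m, hm2, hml⟩ := hm η hη hη2
  set δ : ℝ := κ * η ^ (1 / β) with hδdef
  have hηβ0 : 0 < η ^ (1 / β) := Real.rpow_pos_of_pos hη _
  have hηβ1 : η ^ (1 / β) ≤ 1 := Real.rpow_le_one hη.le (by linarith) (by positivity)
  have hδ : 0 < δ := by positivity
  have hδ1 : δ ≤ 1 := mul_le_one₀ hκ1 hηβ0.le hηβ1
  have hδβ : Ct * (2 * δ) ^ β ≤ η / 2 := by
    rw [Real.mul_rpow zero_le_two hδ.le, hδdef, Real.mul_rpow hκ0.le hηβ0.le, hκ,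
      ← Real.rpow_mul hq0.le, ← Real.rpow_mul hη.le, neg_mul, one_div, inv_mul_cancel₀ hβ.ne',
      Real.rpow_one, Real.rpow_neg_one]
    have h1 : Ct * 2 ^ β * q⁻¹ ≤ 1 / 2 := by
      rw [← div_eq_mul_inv, div_le_iff₀ hq0]; linarith
    calc _ = Ct * 2 ^ β * q⁻¹ * η := by ring
      _ ≤ 1 / 2 * η := by gcongr
      _ = _ := by ring
  have hδn : δ ^ (-(dstar : ℝ)) = κ ^ (-(dstar : ℝ)) * η ^ (-((dstar : ℝ) / β)) := by
    rw [hδdef, Real.mul_rpow hκ0.le hηβ0.le, ← Real.rpow_mul hη.le]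
    congr 2; ring
  obtain ⟨Z, hZc, hZ⟩ := hlat δ hδ hδ1
  set E : ℝ := η ^ (-((dstar : ℝ) / β)) with hE
  have hE0 : 0 < E := Real.rpow_pos_of_pos hη _
  have hE1 : 1 ≤ E := Real.one_le_rpow_of_pos_of_le_one_of_nonpos hη (by linarith) (by
    rw [neg_nonpos]; positivity)
  have hcount : (Z.card : ℝ) * Fintype.card J * B ≤ T * E := by
    rw [hδn] at hZc
    calc _ ≤ Cl * (κ ^ (-(dstar : ℝ)) * E) * Fintype.card J * B := by gcongr
      _ = _ := by rw [hTdef]; ring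
  have hlog : Real.log 2 ≤ Real.log (1 / η) := by
    refine Real.log_le_log two_pos ?_
    rw [le_div_iff₀ hη]; linarith
  have hdepth : n + 5 + (d + k) * (3 * m + 5) ≤ L := by
    have h1 : (5 + 5 * (d + k) : ℝ) ≤ (5 + 5 * (d + k)) / Real.log 2 * Real.log (1 / η) := by
      rw [div_mul_eq_mul_div, le_div_iff₀ hl2]
      gcongr
    have h2 : ((d + k) * (3 * m) : ℝ) ≤ (d + k) * (3 * (c₂ * Real.log (1 / η))) := by gcongr
    have h3 : ((n + 5 + (d + k) * (3 * m + 5) : ℕ) : ℝ) ≤ L := by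
      push_cast
      linarith
    exact_mod_cast h3
  have hL1 : (1 : ℝ) ≤ L := by
    have : 1 ≤ L := by omega
    exact_mod_cast this
  -- The Taylor centres stay in a fixed box.
  have hcorner : ∀ z ∈ Z, ∀ i, |corner δ z i| ≤ R + 2 := by
    intro z hz i
    obtain ⟨x, hx, hxz⟩ := (hZ z).1 hz
    have h1 : |x i| ≤ R := (norm_le_pi_norm x i).trans (hR x hx)
    have h2 := hxz i
    have h3 : |x i - δ * z i| < δ := by
      have e : x i - δ * z i = (x i / δ - z i) * δ := by field_simp
      rw [e, abs_mul, abs_of_pos hδ]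
      exact mul_lt_of_lt_one_left hδ h2
    rw [abs_le] at h1 ⊢
    rw [abs_lt] at h3
    rw [corner, mul_sub, mul_one]
    constructor <;> linarith
  choose c hcA hc using fun z : Fin d → ℤ => hT f hf (corner δ z)
  have hb : ∀ z j, |c z j * (2 * δ) ^ (wd j).length| ≤ B := by
    intro z j
    rw [abs_mul, abs_of_pos (by positivity : 0 < (2 * δ) ^ (wd j).length)]
    refine le_trans (mul_le_mul (hcA z j) ?_ (by positivity) hA) hAB
    calc (2 * δ) ^ (wd j).length ≤ 2 ^ (wd j).length := by gcongr; linarith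
      _ ≤ 2 ^ k := pow_le_pow_right₀ one_le_two (hk j)
  have hn3 : (R + 2) / (2 * δ) ≤ 2 ^ n := by
    refine le_trans (le_of_eq ?_) hn2
    rw [Real.rpow_neg hη.le, hδdef]
    field_simp
  have hp' : Z.card * Fintype.card J * B * w ≤ p := by
    have h1 : ((Z.card * Fintype.card J * B * w : ℕ) : ℝ) ≤ p := by
      push_cast
      calc _ ≤ T * E * w := by gcongr
        _ ≤ (T * w + 1) * E := by linarith
        _ ≤ p := hp.le
    exact_mod_cast h1
  have hs' : Z.card * Fintype.card J * B * (L * (w * (w + d + 1)) + 1) ≤ s := by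
    have h1 : ((Z.card * Fintype.card J * B * (L * (w * (w + d + 1)) + 1) : ℕ) : ℝ) ≤ s := by
      push_cast
      calc _ ≤ T * E * (L * (w * (w + d + 1)) + L) := by gcongr
        _ = T * (w * (w + d + 1) + 1) * (L * E) := by ring
        _ ≤ (T * (w * (w + d + 1) + 1) + 1) * (L * E) := by
          have : 0 ≤ (L : ℝ) * E := by positivity
          linarith
        _ ≤ s := by linarith
    exact_mod_cast h1
  obtain ⟨g, hg, hgx⟩ := exists_uniformClass_sum (by omega : 0 < B) hk hδ (by linarith) hcorner hb
    hn3 hw hdepth hp' hs'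
  refine ⟨g, hg, fun x hx => ?_⟩
  have h1 := hgx x
  have h2 := abs_sub_sum_localMonomial_le hβ hCt hδ hc (Z := Z) (x := x)
    fun z hz => (hZ z).2 ⟨x, hx, hz⟩
  have h3 : (Z.card : ℝ) * Fintype.card J * B * ((d + k) * (1 / 4 ^ m)) ≤ η / 2 := by
    have h4 : (2 : ℝ) ^ m ≤ 4 ^ m := by gcongr; norm_num
    have h5 : 2 * (T * (d + k)) * (E * η⁻¹) ≤ 4 ^ m := by
      refine le_trans (le_of_eq ?_) (hm2.trans h4)
      rw [hE, neg_add, Real.rpow_add hη, Real.rpow_neg_one]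
      ring
    calc _ ≤ T * E * ((d + k) * (1 / 4 ^ m)) := by gcongr
      _ = 2 * (T * (d + k)) * (E * η⁻¹) / 4 ^ m * (η / 2) := by field_simp
      _ ≤ 1 * (η / 2) := by
        gcongr
        rw [div_le_one (by positivity)]
        exact h5
      _ = _ := one_mul _
  rw [abs_sub_comm] at h2
  calc |g x 0 - f x| ≤ _ := abs_sub_le _ _ _
    _ ≤ η / 2 + η / 2 := add_le_add (h1.trans h3) (h2.trans hδβ)
    _ = η := by ring
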